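/- Let $\mathbb{T}^2=(\mathbb{R}/\mathbb{Z})^2$, $\kappa>0$, $T>0$ and $m^\star>m>1$. For $s\in\mathbb{R}$ let $H^s(\mathbb{T}^2)$ be the space of real mean-free functions (distributions, if $s<0$) $\sum_{k\in\mathbb{Z}^2\setminus\{0\}}c_k e^{2\pi i k\cdot x}$, $\overline{c_k}=c_{-k}$, with norm $\|\cdot\|_{H^s}^2=\sum_k\|k\|^{2s}|c_k|^2<\infty$. Let $H$ and $V$ be the spaces of real mean-free divergence-free vector fields $\mathbf v=\sum_{k\ne0}v_k\frac{k^\perp}{\|k\|}e^{2\pi i k\cdot x}$, where $k^\perp=(-k_2,k_1)$ and $\overline{v_k}=-v_{-k}$, with finite norms $\|\mathbf v\|_H^2=\sum_k\|k\|^{2m}|v_k|^2$ and $\|\mathbf v\|_V^2=\sum_k\|k\|^{2m^\star}|v_k|^2$ respectively, and put $B_V^r(\mathbf v_0)=\{\mathbf v\in V:\|\mathbf v-\mathbf v_0\|_V\le r\}$, $B_H^\epsilon(\mathbf v_0)=\{\mathbf v\in H:\|\mathbf v-\mathbf v_0\|_H\le\epsilon\}$. Let $\theta_0^{(1)},\theta_0^{(2)}\in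 H^m(\mathbb{T}^2)$ satisfy $(\nabla\theta_0^{(1)}(x))^\perp\cdot\nabla\theta_0^{(2)}(x)\neq0$ for almost every $x\in\mathbb{T}^2$, where $(a,b)^\perp=(-b,a)$. For $\mathbf v\in H$ and $i=1,2$ let $\theta^{(i)}(\mathbf v)$ be the weak solution on $[0,T]$ of $$\partial_t\theta=-\mathbf v\cdot\nabla\theta+\kappa\Delta\theta,\qquad \theta(0)=\theta_0^{(i)},$$ that is, $\theta\in C([0,T];H^m)\cap L^2(0,T;H^{m+1})$, $\partial_t\theta\in L^2(0,T;H^{m-1})$, and $\langle\partial_t\theta,\phi\rangle_{H^{-1}\times H^1}+\langle\mathbf v\cdot\nabla\theta,\phi\rangle_{L^2}+\kappa\langle\nabla\theta,\nabla\phi\rangle_{L^2}=0$ for almost every $t\in[0,T]$ and all $\phi\in H^1(\mathbb{T}^2)$. Let $\tilde{\mathcal S}:H\to L^2([0,T]\times\mathbb{T}^2)^2$, $\tilde{\mathcal S}(\mathbf v)=(\theta^{(1)}(\mathbf v),\theta^{(2)}(\mathbf v))$. Then $\tilde{\mathcal S}$ is well defined (for every $\mathbf v\in H$ and $i=1,2$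 the weak solution exists and is unique as an element of $L^2([0,T]\times\mathbb{T}^2)$) and injective. For every $\mathbf v_0\in V$ and $r>0$, the inverse $\tilde{\mathcal S}^{-1}:\tilde{\mathcal S}(B_V^r(\mathbf v_0))\to H$ is continuous (with respect to the norms of $L^2([0,T]\times\mathbb{T}^2)^2$ and $H$). Moreover, for every $\mathbf v_0\in V$, $r>0$ and $\epsilon>0$ there exists $\delta>0$ such that $$\left\{\mathbf v\in H:\|\tilde{\mathcal S}(\mathbf v)-\tilde{\mathcal S}(\mathbf v_0)\|_{L^2([0,T]\times\mathbb{T}^2)^2}<\delta\right\}\cap B_V^r(\mathbf v_0)\subset B_H^\epsilon(\mathbf v_0).$$ -/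

import Mathlib

open MeasureTheory Set
open scoped ENNReal ComplexConjugate

noncomputable section

namespace AdvectionDiffusion

/-! ### The torus and Fourier series -/

/-- The torus `𝕋² = (ℝ/ℤ)²`, i.e. the periodic unit square. -/
abbrev T2 : Type := UnitAddTorus (Fin 2)

/-- Lebesgue measure on the periodic unit square (total mass one). -/
abbrev area : Measure T2 := Measure.pi fun _ => AddCircle.haarAddCircle

/-- The Euclidean norm `‖k‖` of a frequency `k ∈ ℤ²`. -/
def freqNorm (k : Fin 2 → ℤ) : ℝ := Real.sqrt ((k 0 : ℝ) ^ 2 + (k 1 : ℝ) ^ 2)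

/-- The rotated frequency `k^⊥ = (-k₂, k₁)`. -/
def freqPerp (k : Fin 2 → ℤ) : Fin 2 → ℤ := ![-k 1, k 0]

/-- The function `x ↦ ∑ₖ cₖ e^{2πi k·x}`, the series being summed in `L²(𝕋²)`. It is used only for
square-summable coefficients with `c₋ₖ = conj cₖ`, for which the sum converges and is real valued, so
that taking the real part only turns it into an `ℝ`-valued function. -/
def fourierSeries (c : (Fin 2 → ℤ) → ℂ) : T2 → ℝ := fun x =>
  ((∑' k, c k • ContinuousMap.toLp (E := ℂ) 2 area ℂ (UnitAddTorus.mFourier k) :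
    Lp ℂ 2 area) x).re

/-! ### Sobolev spaces of periodic functions -/

lemma freqNorm_nonneg (k : Fin 2 → ℤ) : 0 ≤ freqNorm k := Real.sqrt_nonneg _

lemma one_le_freqNorm {k : Fin 2 → ℤ} (hk : k ≠ 0) : 1 ≤ freqNorm k := by
  have h : (1 : ℤ) ≤ k 0 ^ 2 + k 1 ^ 2 := by
    by_contra hlt
    have h0 := sq_nonneg (k 0)
    have h1 := sq_nonneg (k 1)
    have e0 : k 0 = 0 := by
      have : k 0 ^ 2 = 0 := by omega
      simpa using this
    have e1 : k 1 = 0 := by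
      have : k 1 ^ 2 = 0 := by omega
      simpa using this
    apply hk
    ext i
    fin_cases i
    · exact e0
    · exact e1
  rw [freqNorm, Real.one_le_sqrt]
  exact_mod_cast h

lemma freqNorm_rpow_sq (s : ℝ) (k : Fin 2 → ℤ) : freqNorm k ^ (2 * s) = (freqNorm k ^ s) ^ 2 := by
  rw [mul_comm, Real.rpow_mul (freqNorm_nonneg k)]
  norm_num

lemma memlp_iff_summable (s : ℝ) (c : (Fin 2 → ℤ) → ℂ) :
    Memℓp (fun k => ((freqNorm k ^ s : ℝ) : ℂ) * c k) 2 ↔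
      Summable fun k => freqNorm k ^ (2 * s) * ‖c k‖ ^ 2 := by
  rw [memℓp_gen_iff (by norm_num)]
  refine summable_congr fun k => ?_
  have h := Real.rpow_nonneg (freqNorm_nonneg k) s
  rw [freqNorm_rpow_sq]
  simp [mul_pow]

/-- The real vector space of families `(cₖ)` of complex coefficients, indexed by `k ∈ ℤ²`, with
`c₀ = 0`, with `conj cₖ = σ c₋ₖ`, and with `∑ₖ ‖k‖^{2s} |cₖ|² < ∞`. -/
def sobolevCoeffs (σ s : ℝ) : Submodule ℝ ((Fin 2 → ℤ) → ℂ) where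
  carrier := {c | c 0 = 0 ∧ (∀ k, conj (c k) = (σ : ℂ) * c (-k)) ∧
    Summable fun k => freqNorm k ^ (2 * s) * ‖c k‖ ^ 2}
  zero_mem' := by simp [summable_zero]
  add_mem' := by
    rintro a b ⟨ha0, ha1, ha2⟩ ⟨hb0, hb1, hb2⟩
    refine ⟨by simp [ha0, hb0], fun k => by simp [ha1, hb1, mul_add], ?_⟩
    rw [← memlp_iff_summable] at *
    convert ha2.add hb2 using 1
    ext k
    simp [mul_add]
  smul_mem' := by
    rintro r a ⟨ha0, ha1, ha2⟩
    refine ⟨by simp [ha0], fun k => by simp [ha1, mul_left_comm], ?_⟩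
    rw [← memlp_iff_summable] at *
    convert ha2.const_smul (r : ℂ) using 1
    ext k
    simp [mul_left_comm]

/-- The Sobolev space of exponent `s`, each element being given by its coefficients. -/
def Sobolev (σ s : ℝ) : Type := ↥(sobolevCoeffs σ s)

/-- The space `H^s(𝕋²)` of real, mean-free scalar functions `∑ₖ cₖ e^{2πi k·x}`: the reality
condition is `conj cₖ = c₋ₖ`. -/
abbrev ScalarH (s : ℝ) : Type := Sobolev 1 s

/-- The space `H^s(𝕋²)` of real, mean-free, divergence-free vector fields
`∑ₖ vₖ (k^⊥ / ‖k‖) e^{2πi k·x}`, given by the family `(vₖ)`: since `k^⊥` is odd in `k`, the reality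
condition is `conj vₖ = -v₋ₖ`. -/
abbrev FlowH (s : ℝ) : Type := Sobolev (-1) s

namespace Sobolev

variable {σ s : ℝ}

/-- The coefficient of frequency `k`. -/
def coeff (c : Sobolev σ s) (k : Fin 2 → ℤ) : ℂ := c.1 k

instance : AddCommGroup (Sobolev σ s) := inferInstanceAs (AddCommGroup ↥(sobolevCoeffs σ s))

instance : Module ℝ (Sobolev σ s) := inferInstanceAs (Module ℝ ↥(sobolevCoeffs σ s))

/-- The map `(cₖ) ↦ (‖k‖^s cₖ)` into `ℓ²`. -/
def toEll2 : Sobolev σ s →ₗ[ℝ] lp (fun _ : Fin 2 → ℤ => ℂ) 2 where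
  toFun c := ⟨fun k => ((freqNorm k ^ s : ℝ) : ℂ) * c.coeff k,
    (memlp_iff_summable s c.1).2 c.2.2.2⟩
  map_add' a b := by
    ext k
    exact mul_add _ (a.coeff k) (b.coeff k)
  map_smul' r a := by
    ext k
    change ((freqNorm k ^ s : ℝ) : ℂ) * ((r : ℂ) * a.coeff k) =
      (r : ℂ) * (((freqNorm k ^ s : ℝ) : ℂ) * a.coeff k)
    ring

lemma toEll2_injective : Function.Injective (toEll2 (σ := σ) (s := s)) := by
  intro a b hab
  apply Subtype.ext
  funext k
  by_cases hk : k = 0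
  · rw [hk, a.2.1, b.2.1]
  · have h : ((freqNorm k ^ s : ℝ) : ℂ) * a.coeff k = ((freqNorm k ^ s : ℝ) : ℂ) * b.coeff k :=
      congrFun (congrArg (fun f : lp (fun _ : Fin 2 → ℤ => ℂ) 2 => (f : (Fin 2 → ℤ) → ℂ)) hab) k
    have hpos : 0 < freqNorm k ^ s :=
      Real.rpow_pos_of_pos (lt_of_lt_of_le one_pos (one_le_freqNorm hk)) s
    exact mul_left_cancel₀ (by exact_mod_cast hpos.ne') h

/-- The `H^s` norm `(∑ₖ ‖k‖^{2s} |cₖ|²)^{1/2}`, as the norm of `(‖k‖^s cₖ)` in `ℓ²`. -/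
instance : NormedAddCommGroup (Sobolev σ s) :=
  NormedAddCommGroup.induced (Sobolev σ s) (lp (fun _ : Fin 2 → ℤ => ℂ) 2) toEll2 toEll2_injective

instance : NormedSpace ℝ (Sobolev σ s) :=
  NormedSpace.induced ℝ (Sobolev σ s) (lp (fun _ : Fin 2 → ℤ => ℂ) 2) toEll2

lemma norm_sq_eq (c : Sobolev σ s) :
    ‖c‖ ^ 2 = ∑' k, freqNorm k ^ (2 * s) * ‖c.coeff k‖ ^ 2 := by
  have h := lp.norm_rpow_eq_tsum (p := 2) (by norm_num) (toEll2 c)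
  have h2 : ‖toEll2 c‖ ^ 2 = ∑' k, ‖(toEll2 c : (Fin 2 → ℤ) → ℂ) k‖ ^ 2 := by
    simpa using h
  refine Eq.trans h2 (tsum_congr fun k => ?_)
  rw [freqNorm_rpow_sq]
  change ‖((freqNorm k ^ s : ℝ) : ℂ) * c.coeff k‖ ^ 2 = _
  simp [mul_pow]

/-- The inclusion of a Sobolev space into one of lower regularity. -/
def incl {s t : ℝ} (h : s ≤ t) (c : Sobolev σ t) : Sobolev σ s :=
  ⟨c.1, c.2.1, c.2.2.1, by
    refine Summable.of_nonneg_of_le (fun k => ?_) (fun k => ?_) c.2.2.2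
    · exact mul_nonneg (Real.rpow_nonneg (freqNorm_nonneg k) _) (by positivity)
    · by_cases hk : k = 0
      · rw [hk, c.2.1]
        simp
      · exact mul_le_mul_of_nonneg_right
          (Real.rpow_le_rpow_of_exponent_le (one_le_freqNorm hk) (by linarith)) (by positivity)⟩

end Sobolev

/-- The scalar function `∑ₖ cₖ e^{2πi k·x}`. -/
def scalarFun {s : ℝ} (c : ScalarH s) : T2 → ℝ := fourierSeries c.coeff

/-- The partial derivative `∂ⱼ` of the scalar function: `∑ₖ 2πi kⱼ cₖ e^{2πi k·x}`. -/
def gradFun {s : ℝ} (c : ScalarH s) (j : Fin 2) : T2 → ℝ :=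
  fourierSeries fun k => 2 * Real.pi * Complex.I * (k j : ℂ) * c.coeff k

/-- The `j`-th component of the flow: `∑ₖ vₖ (k^⊥ⱼ / ‖k‖) e^{2πi k·x}`. -/
def velocity {s : ℝ} (v : FlowH s) (j : Fin 2) : T2 → ℝ :=
  fourierSeries fun k => v.coeff k * ((freqPerp k j : ℂ) / (freqNorm k : ℂ))

/-! ### The advection-diffusion equation -/

/-- `θ` is, on the time interval `[0, T]`, a weak solution of
`∂ₜθ = -v · ∇θ + κ Δθ`, `θ(0) = θ₀`, in the class `θ ∈ C([0,T]; H^m) ∩ L²(0,T; H^{m+1})` with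
`∂ₜθ ∈ L²(0,T; H^{m-1})`. Here `Θ` is `θ` regarded as an `H^{m+1}`-valued function, and `dθ` is `∂ₜθ`,
each Fourier coefficient of `θ` being the integral of that of `dθ`. The pairing of `H⁻¹` with `H¹`
is `∑ₖ (∂ₜθ)ₖ conj φₖ`, a real number. -/
structure IsWeakSolution {m : ℝ} (κ T : ℝ) (v : FlowH m) (θ₀ : ScalarH m)
    (θ : ℝ → ScalarH m) : Prop where
  continuousOn : ContinuousOn θ (Icc 0 T)
  initial : θ 0 = θ₀
  weak : ∃ (Θ : ℝ → ScalarH (m + 1)) (dθ : ℝ → ScalarH (m - 1)),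
    MemLp Θ 2 (volume.restrict (Icc 0 T)) ∧
    MemLp dθ 2 (volume.restrict (Icc 0 T)) ∧
    (∀ᵐ t ∂(volume.restrict (Icc 0 T)), ∀ k, (Θ t).coeff k = (θ t).coeff k) ∧
    (∀ t ∈ Icc 0 T, ∀ k,
      (θ t).coeff k = (θ 0).coeff k + ∫ τ in (0 : ℝ)..t, (dθ τ).coeff k) ∧
    ∀ᵐ t ∂(volume.restrict (Icc 0 T)), ∀ φ : ScalarH 1,
      (∑' k, (dθ t).coeff k * conj (φ.coeff k)).re
        + ∫ x, (∑ j, velocity v j x * gradFun (Θ t) j x) * scalarFun φ x ∂area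
        + κ * ∫ x, ∑ j, gradFun (Θ t) j x * gradFun φ j x ∂area = 0

/-- The measure `dt dx` on `[0, T] × 𝕋²`. -/
abbrev spaceTime (T : ℝ) : Measure (ℝ × T2) := (volume.restrict (Icc 0 T)).prod area

/-- The space `L²([0, T] × 𝕋²)`. -/
abbrev SpaceTimeL2 (T : ℝ) : Type := Lp ℝ 2 (spaceTime T)

/-- `u ∈ L²([0, T] × 𝕋²)` is the scalar field `(t, x) ↦ θ(t, x)` of a weak solution `θ`. -/
def IsSolutionField {m : ℝ} (κ T : ℝ) (v : FlowH m) (θ₀ : ScalarH m) (u : SpaceTimeL2 T) : Prop :=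
  ∃ θ : ℝ → ScalarH m, IsWeakSolution κ T v θ₀ θ ∧
    ∀ᵐ t ∂(volume.restrict (Icc 0 T)), ∀ᵐ x ∂area, u (t, x) = scalarFun (θ t) x

/-- The solution `θ(·, v, θ₀)`, as an element of `L²([0, T] × 𝕋²)`. -/
def solution {m : ℝ} (κ T : ℝ) (θ₀ : ScalarH m) (v : FlowH m) : SpaceTimeL2 T :=
  Classical.epsilon (IsSolutionField κ T v θ₀)

/-- The paired solution map `v ↦ (θ(·, v, θ₀⁽¹⁾), θ(·, v, θ₀⁽²⁾))` from `H` to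
`L²([0, T] × 𝕋²)²`, with the norm `(‖u₁‖² + ‖u₂‖²)^{1/2}` on the target. -/
def pairedSolutionMap {m : ℝ} (κ T : ℝ) (θ₀ : Fin 2 → ScalarH m) (v : FlowH m) :
    PiLp 2 (fun _ : Fin 2 => SpaceTimeL2 T) :=
  WithLp.toLp 2 fun i => solution κ T (θ₀ i) v

/-- The gradients of the two functions are transverse almost everywhere:
`(∇θ₁)^⊥ · ∇θ₂ ≠ 0` for a.e. `x`, where `(a, b)^⊥ = (-b, a)`. -/
def TransverseGradients {m : ℝ} (θ₀ : Fin 2 → ScalarH m) : Prop :=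
  ∀ᵐ x ∂area, -gradFun (θ₀ 0) 1 x * gradFun (θ₀ 1) 0 x
    + gradFun (θ₀ 0) 0 x * gradFun (θ₀ 1) 1 x ≠ 0

/-- The ball `{v ∈ V : ‖v - v₀‖_V ≤ r}` of `V = H^{m'}`, as a subset of `H = H^m`. -/
def ballV {m m' : ℝ} (h : m ≤ m') (v₀ : FlowH m') (r : ℝ) : Set (FlowH m) :=
  Sobolev.incl h '' Metric.closedBall v₀ r

end AdvectionDiffusion

end

open AdvectionDiffusion

noncomputable section

namespace AdvectionDiffusion

/-! The argument is topological: a continuous injective map into a Hausdorff space, restricted to a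
set with compact closure, has a continuous inverse on the image (`continuousOn_invFun_image`). A
ball of `V` has compact closure in `H` by Rellich's theorem, since `m < m'`
(`isCompact_closure_ballV`). It remains to show that the paired solution map is well defined,
continuous and injective on all of `H`; the last claim with `δ` is continuity of the inverse at the
point `v₀`.

Well-posedness and continuity. Since `m > 1`, `H^m` embeds into the absolutely convergent Fourier
series, and Young's inequality makes `(v, θ) ↦ v · ∇θ` a bounded bilinear map `H^m × H^m → H^{m-1}`
(`adv`). By Parseval the weak formulation is equivalent to one linear ODE for each Fourier
coefficient (`weak_form_iff`). Duhamel's formula for these ODEs gains one derivative uniformly in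
time, so weak solutions are exactly the fixed points of an affine map of `C([0,T]; H^m)` whose
linear part `volterra` depends linearly on `v`. The n-th power of this linear part is small because
of a factor `1/n!`, so `1 - volterra` is invertible. This gives existence and uniqueness, and
continuity of operator inversion gives continuity in `v` (`continuous_solCurve`).

Injectivity. If the solutions for `v` and `w` agree, their time derivatives at time 0 agree, so `(v
- w) · ∇θ₀ = 0` (`adv_eq_of_solCurve_eq`). For two initial data with transverse gradients this is,
at almost every point, an invertible 2×2 linear system for `v - w`. -/

lemma freqNorm_neg (k : Fin 2 → ℤ) : freqNorm (-k) = freqNorm k := by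
  simp [freqNorm]

lemma freqNorm_pos {k : Fin 2 → ℤ} (hk : k ≠ 0) : 0 < freqNorm k :=
  one_pos.trans_le (one_le_freqNorm hk)

lemma freqNorm_rpow_nonneg (k : Fin 2 → ℤ) (s : ℝ) : 0 ≤ freqNorm k ^ s :=
  Real.rpow_nonneg (freqNorm_nonneg k) s

/-! ### Sobolev spaces: completeness, continuity and measurability by coefficients, absolute
convergence -/

namespace Sobolev

variable {σ s t : ℝ}

lemma ext {a b : Sobolev σ s} (h : ∀ k, a.coeff k = b.coeff k) : a = b :=
  Subtype.ext (funext h)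

@[simp] lemma coeff_zero_freq (c : Sobolev σ s) : c.coeff 0 = 0 := c.2.1

lemma conj_coeff (c : Sobolev σ s) (k : Fin 2 → ℤ) :
    conj (c.coeff k) = (σ : ℂ) * c.coeff (-k) := c.2.2.1 k

@[simp] lemma coeff_add (a b : Sobolev σ s) (k : Fin 2 → ℤ) :
    (a + b).coeff k = a.coeff k + b.coeff k := rfl

@[simp] lemma coeff_sub (a b : Sobolev σ s) (k : Fin 2 → ℤ) :
    (a - b).coeff k = a.coeff k - b.coeff k := rfl

@[simp] lemma coeff_neg (a : Sobolev σ s) (k : Fin 2 → ℤ) : (-a).coeff k = -a.coeff k := rfl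

@[simp] lemma coeff_zero (k : Fin 2 → ℤ) : (0 : Sobolev σ s).coeff k = 0 := rfl

@[simp] lemma coeff_smul (r : ℝ) (a : Sobolev σ s) (k : Fin 2 → ℤ) :
    (r • a).coeff k = (r : ℂ) * a.coeff k := rfl

@[simp] lemma coeff_incl (h : s ≤ t) (c : Sobolev σ t) (k : Fin 2 → ℤ) :
    (incl h c).coeff k = c.coeff k := by
  delta coeff incl
  rfl

lemma summable_coeff (c : Sobolev σ s) :
    Summable fun k => freqNorm k ^ (2 * s) * ‖c.coeff k‖ ^ 2 := c.2.2.2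

lemma weight_nonneg (s : ℝ) (k : Fin 2 → ℤ) (z : ℂ) : 0 ≤ freqNorm k ^ (2 * s) * ‖z‖ ^ 2 :=
  mul_nonneg (freqNorm_rpow_nonneg _ _) (sq_nonneg _)

lemma sum_le_norm_sq (c : Sobolev σ s) (F : Finset (Fin 2 → ℤ)) :
    ∑ k ∈ F, freqNorm k ^ (2 * s) * ‖c.coeff k‖ ^ 2 ≤ ‖c‖ ^ 2 := by
  rw [norm_sq_eq]
  exact c.summable_coeff.sum_le_tsum F fun k _ => weight_nonneg s k _

lemma norm_sq_le {c : Sobolev σ s} {M : ℝ}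
    (h : ∀ F : Finset (Fin 2 → ℤ), ∑ k ∈ F, freqNorm k ^ (2 * s) * ‖c.coeff k‖ ^ 2 ≤ M) :
    ‖c‖ ^ 2 ≤ M := by
  rw [norm_sq_eq]
  exact c.summable_coeff.tsum_le_of_sum_le h

/-- The element of `Sobolev σ s` with given coefficients. -/
def ofCoeff (c : (Fin 2 → ℤ) → ℂ) (h0 : c 0 = 0) (hc : ∀ k, conj (c k) = (σ : ℂ) * c (-k))
    (hs : Summable fun k => freqNorm k ^ (2 * s) * ‖c k‖ ^ 2) : Sobolev σ s :=
  ⟨c, h0, hc, hs⟩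

@[simp] lemma coeff_ofCoeff (c : (Fin 2 → ℤ) → ℂ) (h0 : c 0 = 0)
    (hc : ∀ k, conj (c k) = (σ : ℂ) * c (-k))
    (hs : Summable fun k => freqNorm k ^ (2 * s) * ‖c k‖ ^ 2) (k : Fin 2 → ℤ) :
    (ofCoeff c h0 hc hs).coeff k = c k := rfl

lemma weight_mul_le_norm_sq (c : Sobolev σ s) (k : Fin 2 → ℤ) :
    freqNorm k ^ (2 * s) * ‖c.coeff k‖ ^ 2 ≤ ‖c‖ ^ 2 := by
  simpa using c.sum_le_norm_sq {k}

lemma norm_coeff_le (c : Sobolev σ s) (k : Fin 2 → ℤ) :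
    ‖c.coeff k‖ ≤ freqNorm k ^ (-s) * ‖c‖ := by
  by_cases hk : k = 0
  · rw [hk, coeff_zero_freq, norm_zero]
    exact mul_nonneg (freqNorm_rpow_nonneg _ _) (norm_nonneg _)
  · have hp : 0 < freqNorm k ^ s := Real.rpow_pos_of_pos (freqNorm_pos hk) s
    have h := c.weight_mul_le_norm_sq k
    rw [freqNorm_rpow_sq, ← mul_pow] at h
    have h2 := (le_abs_self _).trans (abs_le_of_sq_le_sq h (norm_nonneg c))
    rw [Real.rpow_neg (freqNorm_nonneg k)]
    rw [← div_eq_inv_mul, le_div_iff₀ hp]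
    linarith

/-- The coefficient of frequency `k`, as a continuous linear map. -/
def coeffL (k : Fin 2 → ℤ) : Sobolev σ s →L[ℝ] ℂ :=
  LinearMap.mkContinuous
    { toFun := fun c => c.coeff k
      map_add' := fun _ _ => rfl
      map_smul' := fun r c => by simp }
    (freqNorm k ^ (-s)) fun c => c.norm_coeff_le k

lemma continuous_coeff (k : Fin 2 → ℤ) : Continuous fun c : Sobolev σ s => c.coeff k :=
  (coeffL k).continuous

lemma toEll2_apply (c : Sobolev σ s) (k : Fin 2 → ℤ) :
    toEll2 c k = ((freqNorm k ^ s : ℝ) : ℂ) * c.coeff k := rfl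

lemma isometry_toEll2 : Isometry (toEll2 (σ := σ) (s := s)) :=
  AddMonoidHomClass.isometry_of_norm _ fun _ => rfl

/-- The weight is inverted by `‖k‖^(-s)`, except possibly at `k = 0`, where the condition `f 0 = 0`
takes over. Both conditions are closed in `ℓ²`, which gives completeness. -/
lemma range_toEll2 : range (toEll2 (σ := σ) (s := s)) =
    {f | f 0 = 0 ∧ ∀ k, conj (f k) = (σ : ℂ) * f (-k)} := by
  ext f
  constructor
  · rintro ⟨c, rfl⟩
    refine ⟨by simp [toEll2_apply], fun k => ?_⟩
    simp only [toEll2_apply, map_mul, Complex.conj_ofReal, conj_coeff, freqNorm_neg]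
    ring
  · rintro ⟨h0, hc⟩
    have key : ∀ k, ((freqNorm k ^ s : ℝ) : ℂ) * (((freqNorm k ^ (-s) : ℝ) : ℂ) * f k) = f k := by
      intro k
      by_cases hk : k = 0
      · rw [hk, h0]
        simp
      · rw [← mul_assoc, ← Complex.ofReal_mul, ← Real.rpow_add (freqNorm_pos hk)]
        simp
    refine ⟨⟨fun k => ((freqNorm k ^ (-s) : ℝ) : ℂ) * f k, by simp [h0], fun k => ?_, ?_⟩, ?_⟩
    · simp only [map_mul, Complex.conj_ofReal, hc, freqNorm_neg]
      ring
    · rw [← memlp_iff_summable]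
      simp_rw [key]
      exact lp.memℓp f
    · ext k
      exact key k

/-- Completeness is needed for the Neumann series inverting `1 - volterra ^ n` and for norm limits
of compact operators in Rellich's theorem. -/
instance : CompleteSpace (Sobolev σ s) := by
  rw [completeSpace_iff_isComplete_range isometry_toEll2.isUniformInducing, range_toEll2]
  have hev : ∀ k, Continuous fun f : lp (fun _ : Fin 2 → ℤ => ℂ) 2 => f k := fun k =>
    (continuous_apply k).comp (lp.uniformContinuous_coe (p := 2)).continuous
  apply IsClosed.isComplete
  refine IsClosed.and (isClosed_eq (hev 0) continuous_const) ?_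
  have : {f : lp (fun _ : Fin 2 → ℤ => ℂ) 2 | ∀ k, conj (f k) = (σ : ℂ) * f (-k)} =
      ⋂ k, {f : lp (fun _ : Fin 2 → ℤ => ℂ) 2 | conj (f k) = (σ : ℂ) * f (-k)} := by
    ext f; simp
  change IsClosed {f : lp (fun _ : Fin 2 → ℤ => ℂ) 2 | ∀ k, conj (f k) = (σ : ℂ) * f (-k)}
  rw [this]
  exact isClosed_iInter fun k => isClosed_eq (Complex.continuous_conj.comp (hev k))
    (continuous_const.mul (hev (-k)))

/-- A map into a Sobolev space with continuous coefficients is continuous if the terms of the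
norm are dominated by a summable family. -/
lemma continuous_of_dominated {X : Type*} [TopologicalSpace X] {f : X → Sobolev σ s}
    (hf : ∀ k, Continuous fun x => (f x).coeff k) {b : (Fin 2 → ℤ) → ℝ} (hb : Summable b)
    (hle : ∀ k x, freqNorm k ^ (2 * s) * ‖(f x).coeff k‖ ^ 2 ≤ b k) : Continuous f := by
  rw [continuous_iff_continuousAt]
  intro x₀
  have hcont : Continuous fun x => ‖f x - f x₀‖ ^ 2 := by
    simp_rw [norm_sq_eq, coeff_sub]
    -- The factor 4 comes from `|a - b|² ≤ 2|a|² + 2|b|²`, both terms being dominated by `b k`.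
    refine continuous_tsum (fun k => ?_) (hb.mul_left 4) fun k x => ?_
    · exact continuous_const.mul (((hf k).sub continuous_const).norm.pow 2)
    · rw [Real.norm_of_nonneg (weight_nonneg s k _)]
      have h1 : ‖(f x).coeff k - (f x₀).coeff k‖ ^ 2 ≤
          2 * ‖(f x).coeff k‖ ^ 2 + 2 * ‖(f x₀).coeff k‖ ^ 2 := by
        have := norm_sub_le ((f x).coeff k) ((f x₀).coeff k)
        have h2 := pow_le_pow_left₀ (norm_nonneg _) this 2
        nlinarith [sq_nonneg (‖(f x).coeff k‖ - ‖(f x₀).coeff k‖)]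
      have h3 := mul_le_mul_of_nonneg_left h1 (freqNorm_rpow_nonneg k (2 * s))
      have := hle k x
      have := hle k x₀
      nlinarith
  have h0 := hcont.tendsto x₀
  rw [sub_self, norm_zero, zero_pow two_ne_zero] at h0
  have h1 := (Real.continuous_sqrt.tendsto 0).comp h0
  rw [Real.sqrt_zero] at h1
  rw [ContinuousAt, tendsto_iff_norm_sub_tendsto_zero]
  refine h1.congr fun x => ?_
  simp [Real.sqrt_sq]

/-- After the isometry into `ℓ²` the map is a pointwise limit of its finite partial sums, each of
which is measurable. -/
lemma aestronglyMeasurable_of_coeff {X : Type*} [MeasurableSpace X] {μ : Measure X}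
    {f : X → Sobolev σ s} (hf : ∀ k, AEStronglyMeasurable (fun x => (f x).coeff k) μ) :
    AEStronglyMeasurable f μ := by
  rw [← isometry_toEll2.isEmbedding.aestronglyMeasurable_comp_iff]
  refine aestronglyMeasurable_of_tendsto_ae (Filter.atTop : Filter (Finset (Fin 2 → ℤ)))
    (f := fun F x => ∑ k ∈ F, lp.single 2 k (toEll2 (f x) k)) (fun F => ?_) ?_
  · refine Finset.aestronglyMeasurable_fun_sum F fun k _ => ?_
    have hc : Continuous fun z : ℂ =>
        (lp.single 2 k z : lp (fun _ : Fin 2 → ℤ => ℂ) 2) :=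
      (lp.singleContinuousLinearMap ℂ (fun _ : Fin 2 → ℤ => ℂ) 2 k).continuous
    exact hc.comp_aestronglyMeasurable ((hf k).const_mul _)
  · exact Filter.Eventually.of_forall fun x => lp.hasSum_single (by norm_num) (toEll2 (f x))

/-- A family of coefficients depending on a parameter defines a square integrable map into a
Sobolev space as soon as the integrals of the terms of the norm are summable. -/
lemma exists_memLp_two {X : Type*} [MeasurableSpace X] {μ : Measure X}
    {y : X → (Fin 2 → ℤ) → ℂ} (h0 : ∀ x, y x 0 = 0)
    (hc : ∀ x k, conj (y x k) = (σ : ℂ) * y x (-k))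
    (hm : ∀ k, AEStronglyMeasurable (fun x => y x k) μ)
    (hs : ∑' k, ∫⁻ x, ENNReal.ofReal (freqNorm k ^ (2 * s) * ‖y x k‖ ^ 2) ∂μ ≠ ∞) :
    ∃ f : X → Sobolev σ s, MemLp f 2 μ ∧ ∀ᵐ x ∂μ, ∀ k, (f x).coeff k = y x k := by
  classical
  have hmk : ∀ k, AEMeasurable
      (fun x => ENNReal.ofReal (freqNorm k ^ (2 * s) * ‖y x k‖ ^ 2)) μ := fun k =>
    (((hm k).norm.aemeasurable.pow_const 2).const_mul _).ennreal_ofReal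
  rw [← lintegral_tsum hmk] at hs
  have hfin := ae_lt_top' (AEMeasurable.tsum hmk) hs
  -- The default value 0 is taken only on the null set where the coefficients fail to be summable.
  set f : X → Sobolev σ s := fun x =>
    if h : Summable fun k => freqNorm k ^ (2 * s) * ‖y x k‖ ^ 2 then
      ofCoeff (y x) (h0 x) (hc x) h else 0 with hf
  have hsum : ∀ᵐ x ∂μ, Summable fun k => freqNorm k ^ (2 * s) * ‖y x k‖ ^ 2 := by
    filter_upwards [hfin] with x hx
    have := ENNReal.summable_toReal hx.ne
    refine this.congr fun k => ?_
    rw [ENNReal.toReal_ofReal (weight_nonneg s k _)]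
  have hcoeff : ∀ᵐ x ∂μ, ∀ k, (f x).coeff k = y x k := by
    filter_upwards [hsum] with x hx k
    rw [hf]
    simp only [dif_pos hx, coeff_ofCoeff]
  have hmeas : AEStronglyMeasurable f μ := aestronglyMeasurable_of_coeff fun k =>
    (hm k).congr (by filter_upwards [hcoeff] with x hx using (hx k).symm)
  refine ⟨f, ⟨hmeas, ?_⟩, hcoeff⟩
  rw [eLpNorm_lt_top_iff_lintegral_rpow_enorm_lt_top (by norm_num) (by norm_num)]
  refine lt_of_le_of_lt (lintegral_mono_ae ?_) hs.lt_top
  filter_upwards [hsum, hcoeff] with x hx hx'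
  rw [← ENNReal.ofReal_tsum_of_nonneg (fun k => weight_nonneg s k _) hx]
  have h2 : ‖f x‖ ^ 2 = ∑' k, freqNorm k ^ (2 * s) * ‖y x k‖ ^ 2 := by
    rw [norm_sq_eq]
    simp_rw [hx']
  rw [← h2, ← ofReal_norm, ENNReal.toReal_ofNat, ENNReal.ofReal_rpow_of_nonneg (norm_nonneg _) (by norm_num)]
  norm_num

/-- The exponent `2s` exceeds the dimension 2. The Euclidean norm dominates the sup norm, for which
this is the lattice sum of Eisenstein series. -/
lemma summable_freqNorm_rpow (hs : 1 < s) :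
    Summable fun k : Fin 2 → ℤ => if k = 0 then 0 else freqNorm k ^ (-(2 * s)) := by
  refine Summable.of_nonneg_of_le (fun k => ?_) (fun k => ?_)
    (EisensteinSeries.summable_one_div_norm_rpow (k := 2 * s) (by linarith))
  · split_ifs
    · exact le_rfl
    · exact freqNorm_rpow_nonneg _ _
  · split_ifs with hk
    · positivity
    · refine Real.rpow_le_rpow_of_nonpos (norm_pos_iff.2 hk) ?_ (by linarith)
      refine (pi_norm_le_iff_of_nonneg (freqNorm_nonneg k)).2 fun i => ?_
      rw [freqNorm, Int.norm_eq_abs, ← Real.sqrt_sq_eq_abs]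
      apply Real.sqrt_le_sqrt
      fin_cases i
      · simpa using sq_nonneg (k 1 : ℝ)
      · simpa using sq_nonneg (k 0 : ℝ)

/-- The constant of the embedding of `H^s` into absolutely convergent Fourier series. -/
def sumConst (s : ℝ) : ℝ :=
  Real.sqrt (∑' k : Fin 2 → ℤ, if k = 0 then 0 else freqNorm k ^ (-(2 * s)))

/-- Cauchy–Schwarz applied to `|c_k| = ‖k‖^(-s) · ‖k‖^s |c_k|`. -/
lemma sum_norm_coeff_le (hs : 1 < s) (c : Sobolev σ s) (F : Finset (Fin 2 → ℤ)) :
    ∑ k ∈ F, ‖c.coeff k‖ ≤ sumConst s * ‖c‖ := by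
  have hw : ∀ k : Fin 2 → ℤ, 0 ≤ if k = 0 then 0 else freqNorm k ^ (-(2 * s)) := fun k => by
    split_ifs
    · exact le_rfl
    · exact freqNorm_rpow_nonneg _ _
  have h1 : ∀ k ∈ F, ‖c.coeff k‖ = Real.sqrt (if k = 0 then 0 else freqNorm k ^ (-(2 * s))) *
      Real.sqrt (freqNorm k ^ (2 * s) * ‖c.coeff k‖ ^ 2) := by
    intro k _
    rw [← Real.sqrt_mul (hw k)]
    by_cases hk : k = 0
    · simp [hk]
    · rw [if_neg hk, ← mul_assoc, ← Real.rpow_add (freqNorm_pos hk), neg_add_cancel,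
        Real.rpow_zero, one_mul, Real.sqrt_sq (norm_nonneg _)]
  rw [Finset.sum_congr rfl h1]
  refine (Real.sum_sqrt_mul_sqrt_le F (fun k => hw k) fun k => weight_nonneg s k _).trans ?_
  refine mul_le_mul (Real.sqrt_le_sqrt ?_) ?_ (Real.sqrt_nonneg _) (Real.sqrt_nonneg _)
  · exact (summable_freqNorm_rpow hs).sum_le_tsum F fun k _ => hw k
  · exact Real.sqrt_le_iff.2 ⟨norm_nonneg _, c.sum_le_norm_sq F⟩

lemma summable_norm_coeff (hs : 1 < s) (c : Sobolev σ s) : Summable fun k => ‖c.coeff k‖ :=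
  summable_of_sum_le (fun _ => norm_nonneg _) (sum_norm_coeff_le hs c)

lemma tsum_norm_coeff_le (hs : 1 < s) (c : Sobolev σ s) :
    ∑' k, ‖c.coeff k‖ ≤ sumConst s * ‖c‖ :=
  (summable_norm_coeff hs c).tsum_le_of_sum_le (sum_norm_coeff_le hs c)

lemma memlp_coeff (hs : 0 ≤ s) (c : Sobolev σ s) : Memℓp c.coeff 2 := by
  have h := (incl hs c).summable_coeff
  simp only [coeff_incl, mul_zero, Real.rpow_zero, one_mul] at h
  rw [memℓp_gen_iff (by norm_num)]
  simpa using h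

end Sobolev

end AdvectionDiffusion

/-! ### Fourier analysis on the torus: Parseval, convolution, functions versus coefficients -/

namespace AdvectionDiffusion

/-- The Hilbert basis of `L²(𝕋²)` given by the exponentials. -/
def torusBasis : HilbertBasis (Fin 2 → ℤ) ℂ (Lp ℂ 2 area) := UnitAddTorus.mFourierBasis

/-- The Fourier coefficient of frequency `k` of a function on the torus. -/
def fcoeff (f : T2 → ℂ) (k : Fin 2 → ℤ) : ℂ := ∫ x, UnitAddTorus.mFourier (-k) x * f x ∂area

lemma torusBasis_apply (k : Fin 2 → ℤ) :
    torusBasis k = ContinuousMap.toLp (E := ℂ) 2 area ℂ (UnitAddTorus.mFourier k) :=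
  congrFun UnitAddTorus.coe_mFourierBasis k

lemma torusBasis_repr (f : Lp ℂ 2 area) (k : Fin 2 → ℤ) : torusBasis.repr f k = fcoeff f k :=
  UnitAddTorus.mFourierBasis_repr f k

lemma hasSum_conj_fcoeff_mul_Lp (f g : Lp ℂ 2 area) :
    HasSum (fun k => conj (fcoeff f k) * fcoeff g k) (∫ x, conj (f x) * g x ∂area) :=
  UnitAddTorus.hasSum_prod_mFourierCoeff f g

lemma norm_mFourier_apply (k : Fin 2 → ℤ) (x : T2) : ‖UnitAddTorus.mFourier k x‖ = 1 := by
  simp only [UnitAddTorus.mFourier, ContinuousMap.coe_mk, norm_prod, fourier_apply,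
    Circle.norm_coe, Finset.prod_const_one]

lemma fcoeff_congr_ae {f g : T2 → ℂ} (h : f =ᵐ[area] g) (k : Fin 2 → ℤ) :
    fcoeff f k = fcoeff g k :=
  integral_congr_ae (by filter_upwards [h] with x hx; rw [hx])

lemma fcoeff_conj (f : T2 → ℂ) (k : Fin 2 → ℤ) :
    fcoeff (fun x => conj (f x)) k = conj (fcoeff f (-k)) := by
  rw [fcoeff, fcoeff, ← integral_conj]
  refine integral_congr_ae (Filter.Eventually.of_forall fun x => ?_)
  simp [UnitAddTorus.mFourier_neg]

lemma integrable_mFourier_mul {f : T2 → ℂ} (hf : Integrable f area) (k : Fin 2 → ℤ) :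
    Integrable (fun x => UnitAddTorus.mFourier k x * f x) area :=
  hf.bdd_mul (c := 1) (UnitAddTorus.mFourier k).continuous.aestronglyMeasurable
    (Filter.Eventually.of_forall fun x => (norm_mFourier_apply k x).le)

lemma fcoeff_add {f g : T2 → ℂ} (hf : Integrable f area) (hg : Integrable g area)
    (k : Fin 2 → ℤ) : fcoeff (fun x => f x + g x) k = fcoeff f k + fcoeff g k := by
  simp only [fcoeff, mul_add]
  exact integral_add (integrable_mFourier_mul hf _) (integrable_mFourier_mul hg _)

lemma hasSum_conj_fcoeff_mul {f g : T2 → ℂ} (hf : MemLp f 2 area) (hg : MemLp g 2 area) :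
    HasSum (fun k => conj (fcoeff f k) * fcoeff g k) (∫ x, conj (f x) * g x ∂area) := by
  have h := hasSum_conj_fcoeff_mul_Lp (hf.toLp f) (hg.toLp g)
  have hi : ∫ x, conj (hf.toLp f x) * hg.toLp g x ∂area = ∫ x, conj (f x) * g x ∂area :=
    integral_congr_ae (by
      filter_upwards [hf.coeFn_toLp, hg.coeFn_toLp] with x h1 h2
      rw [h1, h2])
  simp_rw [fcoeff_congr_ae hf.coeFn_toLp, fcoeff_congr_ae hg.coeFn_toLp] at h
  rwa [hi] at h

lemma ae_eq_of_fcoeff_eq {f g : T2 → ℂ} (hf : MemLp f 2 area) (hg : MemLp g 2 area)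
    (h : ∀ k, fcoeff f k = fcoeff g k) : f =ᵐ[area] g := by
  have h1 : hf.toLp f = hg.toLp g := by
    apply torusBasis.repr.injective
    ext k
    rw [torusBasis_repr, torusBasis_repr, fcoeff_congr_ae hf.coeFn_toLp,
      fcoeff_congr_ae hg.coeFn_toLp, h]
  exact (MemLp.toLp_eq_toLp_iff hf hg).1 h1

/-- The Fourier coefficients of a product are given by the convolution. -/
lemma hasSum_fcoeff_mul {f g : T2 → ℂ} (hf : MemLp f 2 area) (hg : MemLp g 2 area)
    (k : Fin 2 → ℤ) :
    HasSum (fun j => fcoeff f (k - j) * fcoeff g j) (fcoeff (fun x => f x * g x) k) := by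
  -- The k-th coefficient of `f g` is the `L²` inner product of `e_k · conj f` with `g`, where `e_k`
  -- is `mFourier k`; Parseval for this pair is the convolution formula.
  have hf' : MemLp (fun x => UnitAddTorus.mFourier k x * conj (f x)) 2 area := by
    refine MemLp.of_le hf.star (f := fun x => UnitAddTorus.mFourier k x * conj (f x))
      ((UnitAddTorus.mFourier k).continuous.aestronglyMeasurable.mul
        hf.star.aestronglyMeasurable) (Filter.Eventually.of_forall fun x => ?_)
    rw [norm_mul, norm_mFourier_apply, one_mul]
    exact le_rfl
  have h := hasSum_conj_fcoeff_mul hf' hg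
  have h1 : ∀ j, conj (fcoeff (fun x => UnitAddTorus.mFourier k x * conj (f x)) j) =
      fcoeff f (k - j) := by
    intro j
    rw [fcoeff, fcoeff, ← integral_conj]
    refine integral_congr_ae (Filter.Eventually.of_forall fun x => ?_)
    simp only [neg_sub, map_mul, Complex.conj_conj, UnitAddTorus.mFourier_neg]
    rw [sub_eq_add_neg, UnitAddTorus.mFourier_add, UnitAddTorus.mFourier_neg]
    ring
  simp_rw [h1] at h
  convert h using 1
  refine integral_congr_ae (Filter.Eventually.of_forall fun x => ?_)
  simp only [map_mul, Complex.conj_conj, UnitAddTorus.mFourier_neg]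
  ring

section FourierSeries

variable {c : (Fin 2 → ℤ) → ℂ}

/-- The sum of a Fourier series with square summable coefficients, as an element of `L²`. -/
def seriesLp (c : (Fin 2 → ℤ) → ℂ) : Lp ℂ 2 area :=
  ∑' k, c k • ContinuousMap.toLp (E := ℂ) 2 area ℂ (UnitAddTorus.mFourier k)

lemma fourierSeries_apply (c : (Fin 2 → ℤ) → ℂ) (x : T2) :
    fourierSeries c x = (seriesLp c x).re := rfl

lemma seriesLp_eq (hc : Memℓp c 2) : seriesLp c = torusBasis.repr.symm ⟨c, hc⟩ := by
  have h := torusBasis.hasSum_repr_symm ⟨c, hc⟩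
  simp_rw [torusBasis_apply] at h
  exact h.tsum_eq

lemma fcoeff_seriesLp (hc : Memℓp c 2) (k : Fin 2 → ℤ) : fcoeff (seriesLp c) k = c k := by
  rw [← torusBasis_repr, seriesLp_eq hc, LinearIsometryEquiv.apply_symm_apply]

lemma memLp_fourierSeries (c : (Fin 2 → ℤ) → ℂ) : MemLp (fourierSeries c) 2 area :=
  (Lp.memLp (seriesLp c)).re

lemma memLp_ofReal_fourierSeries (c : (Fin 2 → ℤ) → ℂ) :
    MemLp (fun x => (fourierSeries c x : ℂ)) 2 area :=
  (memLp_fourierSeries c).ofReal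

/-- Under the Hermitian symmetry the `L²` sum and its conjugate have the same coefficients, so the
sum is real and the real part in `fourierSeries` discards nothing. -/
lemma ofReal_fourierSeries_ae (hc : Memℓp c 2) (hh : ∀ k, conj (c k) = c (-k)) :
    (fun x => (fourierSeries c x : ℂ)) =ᵐ[area] seriesLp c := by
  have h1 : (fun x => conj (seriesLp c x)) =ᵐ[area] seriesLp c := by
    refine ae_eq_of_fcoeff_eq (Lp.memLp (seriesLp c)).star (Lp.memLp _) fun k => ?_
    rw [fcoeff_conj, fcoeff_seriesLp hc, fcoeff_seriesLp hc, hh, neg_neg]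
  filter_upwards [h1] with x hx
  rw [fourierSeries_apply]
  exact Complex.conj_eq_iff_re.1 hx

lemma fcoeff_fourierSeries (hc : Memℓp c 2) (hh : ∀ k, conj (c k) = c (-k)) (k : Fin 2 → ℤ) :
    fcoeff (fun x => (fourierSeries c x : ℂ)) k = c k := by
  rw [fcoeff_congr_ae (ofReal_fourierSeries_ae hc hh), fcoeff_seriesLp hc]

/-- **Parseval's identity** for a real function and a real Fourier series. -/
lemma integral_mul_fourierSeries {f : T2 → ℝ} (hf : MemLp f 2 area)
    (hc : Memℓp c 2) (hh : ∀ k, conj (c k) = c (-k)) :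
    HasSum (fun k => (fcoeff (fun x => (f x : ℂ)) k * conj (c k)).re)
      (∫ x, f x * fourierSeries c x ∂area) := by
  have h := hasSum_conj_fcoeff_mul (memLp_ofReal_fourierSeries c) (MemLp.ofReal (K := ℂ) hf)
  simp_rw [fcoeff_fourierSeries hc hh] at h
  have h2 := Complex.hasSum_re h
  have h3 : (∫ x, conj (fourierSeries c x : ℂ) * ((f x : ℝ) : ℂ) ∂area).re =
      ∫ x, f x * fourierSeries c x ∂area := by
    have : ∀ x, conj (fourierSeries c x : ℂ) * ((f x : ℝ) : ℂ) =
        ((f x * fourierSeries c x : ℝ) : ℂ) := fun x => by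
      rw [Complex.conj_ofReal]; push_cast; ring
    simp_rw [this]
    rw [integral_complex_ofReal, Complex.ofReal_re]
  have h4 : (∫ x, conj (fourierSeries c x : ℂ) * ((RCLike.ofReal (f x) : ℂ)) ∂area).re =
      ∫ x, f x * fourierSeries c x ∂area := h3
  rw [h4] at h2
  refine h2.congr_fun fun k => ?_
  rw [mul_comm]
  rfl

/-- The sum of an absolutely convergent Fourier series, as a continuous function. -/
def seriesCont (c : (Fin 2 → ℤ) → ℂ) : C(T2, ℂ) := ∑' k, c k • UnitAddTorus.mFourier k

lemma summable_smul_mFourier (hc : Summable fun k => ‖c k‖) :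
    Summable fun k => c k • (UnitAddTorus.mFourier k : C(T2, ℂ)) :=
  Summable.of_norm (by simpa [norm_smul, UnitAddTorus.mFourier_norm] using hc)

lemma norm_seriesCont_le (hc : Summable fun k => ‖c k‖) : ‖seriesCont c‖ ≤ ∑' k, ‖c k‖ := by
  refine tsum_of_norm_bounded hc.hasSum fun k => ?_
  rw [norm_smul, UnitAddTorus.mFourier_norm, mul_one]

lemma fourierSeries_ae_eq_seriesCont (hc : Summable fun k => ‖c k‖) :
    fourierSeries c =ᵐ[area] fun x => (seriesCont c x).re := by
  have h1 : seriesLp c = ContinuousMap.toLp (E := ℂ) 2 area ℂ (seriesCont c) := by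
    rw [seriesLp, seriesCont, ContinuousLinearMap.map_tsum _ (summable_smul_mFourier hc)]
    simp_rw [map_smul]
  have h2 := ContinuousMap.coeFn_toLp (p := 2) (𝕜 := ℂ) area (seriesCont c)
  filter_upwards [h2] with x hx
  rw [fourierSeries_apply, h1, hx]

end FourierSeries

/-- Elements of `H^s`, `s > 1`, as continuous functions on the torus. -/
def contFun {s : ℝ} (hs : 1 < s) : ScalarH s →L[ℝ] C(T2, ℝ) :=
  LinearMap.mkContinuous
    { toFun := fun c => ⟨fun x => (seriesCont c.coeff x).re, by fun_prop⟩
      map_add' := fun a b => by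
        ext x
        have h : seriesCont (a + b).coeff = seriesCont a.coeff + seriesCont b.coeff := by
          rw [seriesCont, seriesCont, seriesCont, ← Summable.tsum_add
            (summable_smul_mFourier (Sobolev.summable_norm_coeff hs a))
            (summable_smul_mFourier (Sobolev.summable_norm_coeff hs b))]
          refine tsum_congr fun k => ?_
          rw [Sobolev.coeff_add]
          ext x
          exact add_mul _ _ _
        simp [h]
      map_smul' := fun r a => by
        ext x
        have h : seriesCont (r • a).coeff = (r : ℂ) • seriesCont a.coeff := by
          rw [seriesCont, seriesCont, ← Summable.tsum_const_smul (r : ℂ)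
            (summable_smul_mFourier (Sobolev.summable_norm_coeff hs a))]
          refine tsum_congr fun k => ?_
          rw [Sobolev.coeff_smul, mul_smul]
        simp [h] } (Sobolev.sumConst s) fun c => by
      refine (ContinuousMap.norm_le _ (mul_nonneg (Real.sqrt_nonneg _) (norm_nonneg _))).2
        fun x => ?_
      refine (Complex.abs_re_le_norm _).trans ?_
      refine ((seriesCont c.coeff).norm_coe_le_norm x).trans ?_
      exact (norm_seriesCont_le (Sobolev.summable_norm_coeff hs c)).trans
        (Sobolev.tsum_norm_coeff_le hs c)

lemma contFun_ae_eq {s : ℝ} (hs : 1 < s) (c : ScalarH s) :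
    contFun hs c =ᵐ[area] scalarFun c :=
  (fourierSeries_ae_eq_seriesCont (Sobolev.summable_norm_coeff hs c)).symm

lemma conj_scalar_coeff {s : ℝ} (c : ScalarH s) (k : Fin 2 → ℤ) :
    conj (c.coeff k) = c.coeff (-k) := by
  rw [Sobolev.conj_coeff, Complex.ofReal_one, one_mul]

lemma conj_flow_coeff {s : ℝ} (v : FlowH s) (k : Fin 2 → ℤ) :
    conj (v.coeff k) = -v.coeff (-k) := by
  rw [Sobolev.conj_coeff, Complex.ofReal_neg, Complex.ofReal_one, neg_one_mul]

lemma scalarFun_injective {s : ℝ} (hs : 0 ≤ s) {a b : ScalarH s}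
    (h : scalarFun a =ᵐ[area] scalarFun b) : a = b := by
  refine Sobolev.ext fun k => ?_
  rw [← fcoeff_fourierSeries (Sobolev.memlp_coeff hs a) (conj_scalar_coeff a) k,
    ← fcoeff_fourierSeries (Sobolev.memlp_coeff hs b) (conj_scalar_coeff b) k]
  refine fcoeff_congr_ae ?_ k
  filter_upwards [h] with x hx
  exact congrArg _ hx

/-- The coefficients of the partial derivative `∂ⱼ`. -/
def gradCoeff {s : ℝ} (c : ScalarH s) (j : Fin 2) (k : Fin 2 → ℤ) : ℂ :=
  2 * Real.pi * Complex.I * (k j : ℂ) * c.coeff k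

lemma conj_gradCoeff {s : ℝ} (c : ScalarH s) (j : Fin 2) (k : Fin 2 → ℤ) :
    conj (gradCoeff c j k) = gradCoeff c j (-k) := by
  simp only [gradCoeff, map_mul, Complex.conj_ofReal, Complex.conj_I, map_intCast,
    conj_scalar_coeff, map_ofNat, Pi.neg_apply, Int.cast_neg]
  ring

lemma freqNorm_sq (k : Fin 2 → ℤ) : freqNorm k ^ 2 = (k 0 : ℝ) ^ 2 + (k 1 : ℝ) ^ 2 :=
  Real.sq_sqrt (by positivity)

lemma abs_le_freqNorm (k : Fin 2 → ℤ) (i : Fin 2) : |(k i : ℝ)| ≤ freqNorm k := by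
  refine abs_le_of_sq_le_sq ?_ (freqNorm_nonneg k)
  rw [freqNorm_sq]
  fin_cases i
  · simpa using sq_nonneg (k 1 : ℝ)
  · simpa using sq_nonneg (k 0 : ℝ)

lemma memlp_gradCoeff {s : ℝ} (hs : 1 ≤ s) (c : ScalarH s) (j : Fin 2) :
    Memℓp (gradCoeff c j) 2 := by
  have h := (Sobolev.incl hs c).summable_coeff
  simp only [Sobolev.coeff_incl, mul_one] at h
  rw [memℓp_gen_iff (by norm_num)]
  refine Summable.of_nonneg_of_le (fun k => by positivity) (fun k => ?_)
    (h.mul_left ((2 * Real.pi) ^ 2))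
  have h1 : ‖gradCoeff c j k‖ = 2 * Real.pi * |(k j : ℝ)| * ‖c.coeff k‖ := by
    simp [gradCoeff, abs_of_pos Real.pi_pos]
  rw [h1, ENNReal.toReal_ofNat, Real.rpow_two, Real.rpow_two, mul_pow, mul_pow, mul_assoc]
  gcongr
  exact abs_le_freqNorm k j

/-- The coefficients of the `j`-th component of a flow. -/
def velCoeff {s : ℝ} (v : FlowH s) (j : Fin 2) (k : Fin 2 → ℤ) : ℂ :=
  v.coeff k * ((freqPerp k j : ℂ) / (freqNorm k : ℂ))

lemma velocity_eq {s : ℝ} (v : FlowH s) (j : Fin 2) :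
    velocity v j = fourierSeries (velCoeff v j) := rfl

lemma freqPerp_neg (k : Fin 2 → ℤ) (j : Fin 2) : freqPerp (-k) j = -freqPerp k j := by
  fin_cases j <;> simp [freqPerp]

lemma abs_freqPerp_le (k : Fin 2 → ℤ) (i : Fin 2) : |(freqPerp k i : ℝ)| ≤ freqNorm k := by
  fin_cases i
  · simpa [freqPerp] using abs_le_freqNorm k 1
  · simpa [freqPerp] using abs_le_freqNorm k 0

lemma conj_velCoeff {s : ℝ} (v : FlowH s) (j : Fin 2) (k : Fin 2 → ℤ) :
    conj (velCoeff v j k) = velCoeff v j (-k) := by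
  simp only [velCoeff, map_mul, conj_flow_coeff, map_div₀, Complex.conj_ofReal, map_intCast,
    freqPerp_neg, freqNorm_neg]
  push_cast
  ring

lemma norm_velCoeff_le {s : ℝ} (v : FlowH s) (j : Fin 2) (k : Fin 2 → ℤ) :
    ‖velCoeff v j k‖ ≤ ‖v.coeff k‖ := by
  rw [velCoeff, norm_mul]
  refine mul_le_of_le_one_right (norm_nonneg _) ?_
  rw [norm_div, Complex.norm_real, Complex.norm_intCast, Real.norm_of_nonneg (freqNorm_nonneg k)]
  exact div_le_one_of_le₀ (abs_freqPerp_le k j) (freqNorm_nonneg k)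

lemma memlp_velCoeff {s : ℝ} (hs : 0 ≤ s) (v : FlowH s) (j : Fin 2) :
    Memℓp (velCoeff v j) 2 :=
  (Sobolev.memlp_coeff hs v).mono' (fun k => norm_velCoeff_le v j k)

/-- Boundedness of the velocity is what puts the product `v · ∇θ` in `L²`. -/
lemma exists_bound_velocity {s : ℝ} (hs : 1 < s) (v : FlowH s) (j : Fin 2) :
    ∃ C, ∀ᵐ x ∂area, ‖velocity v j x‖ ≤ C := by
  have hsum : Summable fun k => ‖velCoeff v j k‖ :=
    Summable.of_nonneg_of_le (fun _ => norm_nonneg _) (norm_velCoeff_le v j)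
      (Sobolev.summable_norm_coeff hs v)
  refine ⟨‖seriesCont (velCoeff v j)‖, ?_⟩
  filter_upwards [fourierSeries_ae_eq_seriesCont hsum] with x hx
  rw [velocity_eq, hx]
  exact (Complex.abs_re_le_norm _).trans ((seriesCont _).norm_coe_le_norm x)

/-- The advection term `v · ∇θ`. -/
def advection {s t : ℝ} (v : FlowH s) (c : ScalarH t) (x : T2) : ℝ :=
  ∑ j, velocity v j x * gradFun c j x

lemma memLp_velocity_mul {s t : ℝ} (hs : 1 < s) (v : FlowH s) (c : ScalarH t) (j : Fin 2) :
    MemLp (fun x => velocity v j x * gradFun c j x) 2 area := by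
  obtain ⟨C, hC⟩ := exists_bound_velocity hs v j
  refine MemLp.of_le_mul (c := C) (memLp_fourierSeries (gradCoeff c j))
    ((memLp_fourierSeries (velCoeff v j)).aestronglyMeasurable.mul
      (memLp_fourierSeries (gradCoeff c j)).aestronglyMeasurable) ?_
  filter_upwards [hC] with x hx
  rw [norm_mul]
  exact mul_le_mul_of_nonneg_right hx (norm_nonneg _)

lemma memLp_advection {s t : ℝ} (hs : 1 < s) (v : FlowH s) (c : ScalarH t) :
    MemLp (advection v c) 2 area :=
  memLp_finsetSum _ fun j _ => memLp_velocity_mul hs v c j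

/-- The terms of the convolution giving the Fourier coefficients of the advection term. -/
def advTerm {s t : ℝ} (v : FlowH s) (c : ScalarH t) (k j : Fin 2 → ℤ) : ℂ :=
  ∑ i, velCoeff v i (k - j) * gradCoeff c i j

lemma hasSum_advTerm {s t : ℝ} (hs : 1 < s) (ht : 1 ≤ t) (v : FlowH s) (c : ScalarH t)
    (k : Fin 2 → ℤ) :
    HasSum (advTerm v c k) (fcoeff (fun x => (advection v c x : ℂ)) k) := by
  have h : ∀ i, HasSum (fun j => velCoeff v i (k - j) * gradCoeff c i j)
      (fcoeff (fun x => ((velocity v i x * gradFun c i x : ℝ) : ℂ)) k) := by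
    intro i
    have := hasSum_fcoeff_mul (memLp_ofReal_fourierSeries (velCoeff v i))
      (memLp_ofReal_fourierSeries (gradCoeff c i)) k
    simp_rw [fcoeff_fourierSeries (memlp_velCoeff (by linarith) v i) (conj_velCoeff v i),
      fcoeff_fourierSeries (memlp_gradCoeff ht c i) (conj_gradCoeff c i)] at this
    simpa only [Complex.ofReal_mul] using! this
  have hint : ∀ i, Integrable (fun x => ((velocity v i x * gradFun c i x : ℝ) : ℂ)) area :=
    fun i => ((memLp_velocity_mul hs v c i).integrable (by norm_num)).ofReal
  have h2 := (h 0).add (h 1)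
  rw [← fcoeff_add (hint 0) (hint 1)] at h2
  convert h2 using 2
  · simp only [advTerm, Fin.sum_univ_two]
  · simp only [advection, Fin.sum_univ_two, Complex.ofReal_add]

end AdvectionDiffusion

/-! ### The bilinear estimate for the advection term -/

namespace AdvectionDiffusion

lemma freqNorm_eq_norm (k : Fin 2 → ℤ) :
    freqNorm k = ‖(!₂[(k 0 : ℝ), (k 1 : ℝ)] : EuclideanSpace ℝ (Fin 2))‖ := by
  rw [EuclideanSpace.norm_eq, freqNorm]
  simp

lemma freqNorm_add_le (k l : Fin 2 → ℤ) : freqNorm (k + l) ≤ freqNorm k + freqNorm l := by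
  rw [freqNorm_eq_norm, freqNorm_eq_norm, freqNorm_eq_norm]
  refine le_trans (le_of_eq ?_) (norm_add_le _ _)
  congr 1
  ext i
  fin_cases i <;> simp

/-- A Leibniz rule on the frequency side: `‖k‖ ≤ 2 max(‖k - j‖, ‖j‖)`, so all `m` derivatives may be
charged to the factor of larger frequency. -/
lemma freqNorm_rpow_mul_le {m : ℝ} (hm : 1 ≤ m) (k j : Fin 2 → ℤ) :
    freqNorm k ^ (m - 1) * freqNorm j ≤
      2 ^ (m - 1) * (freqNorm (k - j) ^ m + freqNorm j ^ m) := by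
  set p := freqNorm (k - j)
  set q := freqNorm j
  have hp : 0 ≤ p := freqNorm_nonneg _
  have hq : 0 ≤ q := freqNorm_nonneg _
  have hM : 0 ≤ max p q := le_max_of_le_left hp
  have h1 : freqNorm k ≤ 2 * max p q := by
    have := freqNorm_add_le (k - j) j
    rw [sub_add_cancel] at this
    linarith [le_max_left p q, le_max_right p q]
  have h2 : max p q ^ m ≤ p ^ m + q ^ m := by
    rcases le_total p q with h | h
    · rw [max_eq_right h]
      linarith [Real.rpow_nonneg hp m]
    · rw [max_eq_left h]
      linarith [Real.rpow_nonneg hq m]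
  calc freqNorm k ^ (m - 1) * q ≤ (2 * max p q) ^ (m - 1) * max p q := by
        refine mul_le_mul (Real.rpow_le_rpow (freqNorm_nonneg k) h1 (by linarith))
          (le_max_right _ _) hq (Real.rpow_nonneg (by positivity) _)
    _ = 2 ^ (m - 1) * max p q ^ m := by
        rw [Real.mul_rpow (by norm_num) hM, mul_assoc,
          ← Real.rpow_add_one' hM (by linarith), sub_add_cancel]
    _ ≤ _ := by gcongr

section Young

variable {a g : (Fin 2 → ℤ) → ℝ}

lemma summable_sub_right (ha : Summable fun k => a k ^ 2) (j : Fin 2 → ℤ) :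
    Summable fun k => a (k - j) ^ 2 :=
  (Equiv.subRight j).summable_iff.2 ha

lemma tsum_sub_right (j : Fin 2 → ℤ) : ∑' k, a (k - j) ^ 2 = ∑' k, a k ^ 2 :=
  (Equiv.subRight j).tsum_eq fun k => a k ^ 2

lemma summable_convolution (ha0 : ∀ k, 0 ≤ a k) (hg0 : ∀ k, 0 ≤ g k)
    (ha : Summable fun k => a k ^ 2) (hg : Summable g) (k : Fin 2 → ℤ) :
    Summable fun j => a (k - j) * g j := by
  refine Summable.of_nonneg_of_le (fun j => mul_nonneg (ha0 _) (hg0 _)) (fun j => ?_)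
    (hg.mul_left (Real.sqrt (∑' k, a k ^ 2)))
  refine mul_le_mul_of_nonneg_right ?_ (hg0 j)
  exact Real.le_sqrt_of_sq_le (ha.le_tsum (k - j) fun _ _ => sq_nonneg _)

/-- **Young's inequality** for the convolution of a square summable and a summable family. -/
lemma sum_sq_convolution_le (ha0 : ∀ k, 0 ≤ a k) (hg0 : ∀ k, 0 ≤ g k)
    (ha : Summable fun k => a k ^ 2) (hg : Summable g) (F : Finset (Fin 2 → ℤ)) :
    ∑ k ∈ F, (∑' j, a (k - j) * g j) ^ 2 ≤ (∑' j, g j) ^ 2 * ∑' k, a k ^ 2 := by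
  -- With the inner sum truncated to a finite `G`, Cauchy–Schwarz with weights `g` and an exchange
  -- of finite sums suffice; the bound is uniform in `G`.
  have hlim : Filter.Tendsto (fun G : Finset (Fin 2 → ℤ) =>
      ∑ k ∈ F, (∑ j ∈ G, a (k - j) * g j) ^ 2) Filter.atTop
      (nhds (∑ k ∈ F, (∑' j, a (k - j) * g j) ^ 2)) :=
    tendsto_finsetSum F fun k _ => ((summable_convolution ha0 hg0 ha hg k).hasSum).pow 2
  refine le_of_tendsto' hlim fun G => ?_
  have hG : ∑ j ∈ G, g j ≤ ∑' j, g j := hg.sum_le_tsum G fun j _ => hg0 j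
  have hG0 : 0 ≤ ∑ j ∈ G, g j := Finset.sum_nonneg fun j _ => hg0 j
  have hA0 : 0 ≤ ∑' k, a k ^ 2 := tsum_nonneg fun k => sq_nonneg _
  calc ∑ k ∈ F, (∑ j ∈ G, a (k - j) * g j) ^ 2
      ≤ ∑ k ∈ F, (∑ j ∈ G, g j) * ∑ j ∈ G, g j * a (k - j) ^ 2 := by
        refine Finset.sum_le_sum fun k _ => ?_
        refine Finset.sum_sq_le_sum_mul_sum_of_sq_le_mul G (fun j _ => hg0 j)
          (fun j _ => mul_nonneg (hg0 j) (sq_nonneg _)) fun j _ => le_of_eq ?_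
        ring
    _ = (∑ j ∈ G, g j) * ∑ j ∈ G, g j * ∑ k ∈ F, a (k - j) ^ 2 := by
        rw [← Finset.mul_sum, Finset.sum_comm]
        simp_rw [Finset.mul_sum]
    _ ≤ (∑ j ∈ G, g j) * ∑ j ∈ G, g j * ∑' k, a k ^ 2 := by
        refine mul_le_mul_of_nonneg_left (Finset.sum_le_sum fun j _ => ?_) hG0
        refine mul_le_mul_of_nonneg_left ?_ (hg0 j)
        rw [← tsum_sub_right j]
        exact (summable_sub_right ha j).sum_le_tsum F fun _ _ => sq_nonneg _
    _ = (∑ j ∈ G, g j) ^ 2 * ∑' k, a k ^ 2 := by rw [← Finset.sum_mul]; ring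
    _ ≤ _ := by gcongr

end Young

variable {m : ℝ}

/-- The Fourier coefficients of the advection term. -/
def advCoeff (v : FlowH m) (c : ScalarH m) (k : Fin 2 → ℤ) : ℂ := ∑' j, advTerm v c k j

lemma summable_advTerm (hm : 1 < m) (v : FlowH m) (c : ScalarH m) (k : Fin 2 → ℤ) :
    Summable (advTerm v c k) := (hasSum_advTerm hm hm.le v c k).summable

lemma advCoeff_eq_fcoeff (hm : 1 < m) (v : FlowH m) (c : ScalarH m) (k : Fin 2 → ℤ) :
    advCoeff v c k = fcoeff (fun x => (advection v c x : ℂ)) k :=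
  (hasSum_advTerm hm hm.le v c k).tsum_eq

lemma norm_gradCoeff_le (c : ScalarH m) (i : Fin 2) (j : Fin 2 → ℤ) :
    ‖gradCoeff c i j‖ ≤ 2 * Real.pi * freqNorm j * ‖c.coeff j‖ := by
  have h1 : ‖gradCoeff c i j‖ = 2 * Real.pi * |(j i : ℝ)| * ‖c.coeff j‖ := by
    simp [gradCoeff, abs_of_pos Real.pi_pos]
  rw [h1]
  gcongr
  exact abs_le_freqNorm j i

lemma norm_advTerm_le (v : FlowH m) (c : ScalarH m) (k j : Fin 2 → ℤ) :
    ‖advTerm v c k j‖ ≤ 4 * Real.pi * (‖v.coeff (k - j)‖ * (freqNorm j * ‖c.coeff j‖)) := by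
  have h : ∀ i, ‖velCoeff v i (k - j) * gradCoeff c i j‖ ≤
      ‖v.coeff (k - j)‖ * (2 * Real.pi * freqNorm j * ‖c.coeff j‖) := fun i => by
    rw [norm_mul]
    exact mul_le_mul (norm_velCoeff_le v i _) (norm_gradCoeff_le c i j) (norm_nonneg _)
      (norm_nonneg _)
  rw [advTerm, Fin.sum_univ_two]
  refine (norm_add_le _ _).trans ?_
  linarith [h 0, h 1]

/-- The constant of the estimate of the advection term. -/
def advConst (m : ℝ) : ℝ := 4 * Real.pi * 2 ^ (m - 1)

lemma advConst_nonneg (m : ℝ) : 0 ≤ advConst m := by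
  unfold advConst; positivity

/-- The two sums are the cases where the derivatives fall on `v` or on `c`. The second is reflected
by `j ↦ k - j`, so that in both the weighted `ℓ²` factor sits at `k - j` and the `ℓ¹` factor at `j`,
as in `sum_sq_convolution_le`. -/
lemma weight_mul_norm_advCoeff_le (hm : 1 < m) (v : FlowH m) (c : ScalarH m) (k : Fin 2 → ℤ) :
    freqNorm k ^ (m - 1) * ‖advCoeff v c k‖ ≤ advConst m *
      (∑' j, freqNorm (k - j) ^ m * ‖v.coeff (k - j)‖ * ‖c.coeff j‖ +
        ∑' j, freqNorm (k - j) ^ m * ‖c.coeff (k - j)‖ * ‖v.coeff j‖) := by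
  have ha : ∀ {σ : ℝ} (u : Sobolev σ m), Summable fun k => (freqNorm k ^ m * ‖u.coeff k‖) ^ 2 := by
    intro σ u
    refine u.summable_coeff.congr fun k => ?_
    rw [freqNorm_rpow_sq, mul_pow]
  have ha0 : ∀ {σ : ℝ} (u : Sobolev σ m), ∀ k, 0 ≤ freqNorm k ^ m * ‖u.coeff k‖ := fun u k =>
    mul_nonneg (freqNorm_rpow_nonneg _ _) (norm_nonneg _)
  have s1 := summable_convolution (ha0 v) (fun k => norm_nonneg _) (ha v)
    (Sobolev.summable_norm_coeff hm c) k
  have s2 := summable_convolution (ha0 c) (fun k => norm_nonneg _) (ha c)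
    (Sobolev.summable_norm_coeff hm v) k
  have e2 : ∑' j, freqNorm (k - j) ^ m * ‖c.coeff (k - j)‖ * ‖v.coeff j‖ =
      ∑' j, ‖v.coeff (k - j)‖ * (freqNorm j ^ m * ‖c.coeff j‖) := by
    rw [← (Equiv.subLeft k).tsum_eq]
    refine tsum_congr fun j => ?_
    simp only [Equiv.subLeft_apply, sub_sub_cancel]
    ring
  have s2' : Summable fun j => ‖v.coeff (k - j)‖ * (freqNorm j ^ m * ‖c.coeff j‖) := by
    refine ((Equiv.subLeft k).summable_iff.2 s2).congr fun j => ?_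
    simp only [Function.comp_apply, Equiv.subLeft_apply, sub_sub_cancel]
    ring
  rw [e2, ← s1.tsum_add s2', ← tsum_mul_left]
  have hs := (summable_advTerm hm v c k).norm
  refine (mul_le_mul_of_nonneg_left (norm_tsum_le_tsum_norm hs) (freqNorm_rpow_nonneg _ _)).trans ?_
  rw [← tsum_mul_left]
  refine (hs.mul_left _).tsum_le_tsum (fun j => ?_) ((s1.add s2').mul_left _)
  have h1 := freqNorm_rpow_mul_le hm.le k j
  have h2 := mul_le_mul_of_nonneg_left (norm_advTerm_le v c k j) (freqNorm_rpow_nonneg k (m - 1))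
  have h3 := mul_le_mul_of_nonneg_right h1
    (mul_nonneg (norm_nonneg (v.coeff (k - j))) (norm_nonneg (c.coeff j)))
  refine h2.trans ?_
  have h4 := mul_le_mul_of_nonneg_left h3 (show 0 ≤ 4 * Real.pi by positivity)
  unfold advConst
  linarith

/-- Young's inequality bounds both convolutions, the `ℓ¹` norm being controlled by `sumConst m`. The
factor 2 comes from `(X + Y)² ≤ 2X² + 2Y²` with the same bound for `X` and `Y`. -/
lemma sum_advCoeff_le (hm : 1 < m) (v : FlowH m) (c : ScalarH m) (F : Finset (Fin 2 → ℤ)) :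
    ∑ k ∈ F, freqNorm k ^ (2 * (m - 1)) * ‖advCoeff v c k‖ ^ 2 ≤
      (2 * advConst m * Sobolev.sumConst m * ‖v‖ * ‖c‖) ^ 2 := by
  have ha : ∀ {σ : ℝ} (u : Sobolev σ m), Summable fun k => (freqNorm k ^ m * ‖u.coeff k‖) ^ 2 := by
    intro σ u
    refine u.summable_coeff.congr fun k => ?_
    rw [freqNorm_rpow_sq, mul_pow]
  have ht : ∀ {σ : ℝ} (u : Sobolev σ m), ∑' k, (freqNorm k ^ m * ‖u.coeff k‖) ^ 2 = ‖u‖ ^ 2 := by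
    intro σ u
    rw [Sobolev.norm_sq_eq]
    refine tsum_congr fun k => ?_
    rw [freqNorm_rpow_sq, mul_pow]
  have ha0 : ∀ {σ : ℝ} (u : Sobolev σ m), ∀ k, 0 ≤ freqNorm k ^ m * ‖u.coeff k‖ := fun u k =>
    mul_nonneg (freqNorm_rpow_nonneg _ _) (norm_nonneg _)
  have hS : ∀ {σ : ℝ} (u : Sobolev σ m), (∑' k, ‖u.coeff k‖) ^ 2 ≤
      (Sobolev.sumConst m * ‖u‖) ^ 2 := fun u =>
    pow_le_pow_left₀ (tsum_nonneg fun _ => norm_nonneg _) (Sobolev.tsum_norm_coeff_le hm u) 2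
  have y1 := sum_sq_convolution_le (ha0 v) (fun k => norm_nonneg _) (ha v)
    (Sobolev.summable_norm_coeff hm c) F
  have y2 := sum_sq_convolution_le (ha0 c) (fun k => norm_nonneg _) (ha c)
    (Sobolev.summable_norm_coeff hm v) F
  rw [ht] at y1 y2
  have y1' := y1.trans (mul_le_mul_of_nonneg_right (hS c) (sq_nonneg ‖v‖))
  have y2' := y2.trans (mul_le_mul_of_nonneg_right (hS v) (sq_nonneg ‖c‖))
  set X := fun k => ∑' j, freqNorm (k - j) ^ m * ‖v.coeff (k - j)‖ * ‖c.coeff j‖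
  set Y := fun k => ∑' j, freqNorm (k - j) ^ m * ‖c.coeff (k - j)‖ * ‖v.coeff j‖
  calc ∑ k ∈ F, freqNorm k ^ (2 * (m - 1)) * ‖advCoeff v c k‖ ^ 2
      ≤ ∑ k ∈ F, advConst m ^ 2 * (2 * X k ^ 2 + 2 * Y k ^ 2) := by
        refine Finset.sum_le_sum fun k _ => ?_
        rw [freqNorm_rpow_sq, ← mul_pow]
        refine (pow_le_pow_left₀ (mul_nonneg (freqNorm_rpow_nonneg _ _) (norm_nonneg _))
          (weight_mul_norm_advCoeff_le hm v c k) 2).trans ?_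
        rw [mul_pow]
        refine mul_le_mul_of_nonneg_left ?_ (sq_nonneg _)
        change (X k + Y k) ^ 2 ≤ _
        nlinarith [sq_nonneg (X k - Y k)]
    _ = advConst m ^ 2 * (2 * ∑ k ∈ F, X k ^ 2 + 2 * ∑ k ∈ F, Y k ^ 2) := by
        rw [← Finset.mul_sum, Finset.sum_add_distrib, ← Finset.mul_sum, ← Finset.mul_sum]
    _ ≤ advConst m ^ 2 * (2 * ((Sobolev.sumConst m * ‖c‖) ^ 2 * ‖v‖ ^ 2) +
        2 * ((Sobolev.sumConst m * ‖v‖) ^ 2 * ‖c‖ ^ 2)) := by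
        gcongr
    _ = _ := by ring

/-- This is where incompressibility enters: `(-j)^⊥ · j = 0`, so `v · ∇θ` is mean-free and belongs
to the scalar Sobolev scale. -/
lemma advTerm_zero (v : FlowH m) (c : ScalarH m) (j : Fin 2 → ℤ) : advTerm v c 0 j = 0 := by
  simp only [advTerm, Fin.sum_univ_two, velCoeff, gradCoeff, freqPerp, zero_sub, Pi.neg_apply]
  simp
  ring

lemma conj_advTerm (v : FlowH m) (c : ScalarH m) (k j : Fin 2 → ℤ) :
    conj (advTerm v c k j) = advTerm v c (-k) (-j) := by
  simp only [advTerm, map_sum, map_mul, conj_velCoeff, conj_gradCoeff]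
  rw [neg_sub_neg, neg_sub]

lemma conj_advCoeff (v : FlowH m) (c : ScalarH m) (k : Fin 2 → ℤ) :
    conj (advCoeff v c k) = advCoeff v c (-k) := by
  rw [advCoeff, advCoeff, Complex.conj_tsum]
  simp_rw [conj_advTerm]
  exact (Equiv.neg (Fin 2 → ℤ)).tsum_eq _

/-- The advection term as an element of `H^{m-1}`. -/
def advH (hm : 1 < m) (v : FlowH m) (c : ScalarH m) : ScalarH (m - 1) :=
  Sobolev.ofCoeff (advCoeff v c) (by simp [advCoeff, advTerm_zero])
    (fun k => by rw [conj_advCoeff, Complex.ofReal_one, one_mul])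
    (summable_of_sum_le (fun k => Sobolev.weight_nonneg _ _ _) (sum_advCoeff_le hm v c))

@[simp] lemma coeff_advH (hm : 1 < m) (v : FlowH m) (c : ScalarH m) (k : Fin 2 → ℤ) :
    (advH hm v c).coeff k = advCoeff v c k := rfl

lemma advH_add_left (hm : 1 < m) (v w : FlowH m) (c : ScalarH m) :
    advH hm (v + w) c = advH hm v c + advH hm w c := Sobolev.ext fun k => by
  rw [Sobolev.coeff_add, coeff_advH, coeff_advH, coeff_advH, advCoeff, advCoeff, advCoeff,
    ← (summable_advTerm hm v c k).tsum_add (summable_advTerm hm w c k)]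
  refine tsum_congr fun j => ?_
  simp only [advTerm, velCoeff, Fin.sum_univ_two, Sobolev.coeff_add]
  ring

lemma advH_smul_left (hm : 1 < m) (r : ℝ) (v : FlowH m) (c : ScalarH m) :
    advH hm (r • v) c = r • advH hm v c := Sobolev.ext fun k => by
  rw [Sobolev.coeff_smul, coeff_advH, coeff_advH, advCoeff, advCoeff, ← tsum_mul_left]
  refine tsum_congr fun j => ?_
  simp only [advTerm, velCoeff, Fin.sum_univ_two, Sobolev.coeff_smul]
  ring

lemma advH_add_right (hm : 1 < m) (v : FlowH m) (c d : ScalarH m) :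
    advH hm v (c + d) = advH hm v c + advH hm v d := Sobolev.ext fun k => by
  rw [Sobolev.coeff_add, coeff_advH, coeff_advH, coeff_advH, advCoeff, advCoeff, advCoeff,
    ← (summable_advTerm hm v c k).tsum_add (summable_advTerm hm v d k)]
  refine tsum_congr fun j => ?_
  simp only [advTerm, gradCoeff, Fin.sum_univ_two, Sobolev.coeff_add]
  ring

lemma advH_smul_right (hm : 1 < m) (r : ℝ) (v : FlowH m) (c : ScalarH m) :
    advH hm v (r • c) = r • advH hm v c := Sobolev.ext fun k => by
  rw [Sobolev.coeff_smul, coeff_advH, coeff_advH, advCoeff, advCoeff, ← tsum_mul_left]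
  refine tsum_congr fun j => ?_
  simp only [advTerm, gradCoeff, Fin.sum_univ_two, Sobolev.coeff_smul]
  ring

lemma norm_advH_le (hm : 1 < m) (v : FlowH m) (c : ScalarH m) :
    ‖advH hm v c‖ ≤ 2 * advConst m * Sobolev.sumConst m * ‖v‖ * ‖c‖ := by
  have h0 : 0 ≤ 2 * advConst m * Sobolev.sumConst m * ‖v‖ * ‖c‖ := by
    have := advConst_nonneg m
    have : 0 ≤ Sobolev.sumConst m := Real.sqrt_nonneg _
    positivity
  have h1 : ‖advH hm v c‖ ^ 2 ≤ (2 * advConst m * Sobolev.sumConst m * ‖v‖ * ‖c‖) ^ 2 :=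
    Sobolev.norm_sq_le (sum_advCoeff_le hm v c)
  exact (sq_le_sq₀ (norm_nonneg _) h0).1 h1

/-- The advection term as a continuous bilinear map `H^m × H^m → H^{m-1}`. -/
def adv (hm : 1 < m) : FlowH m →L[ℝ] ScalarH m →L[ℝ] ScalarH (m - 1) :=
  LinearMap.mkContinuous₂
    (LinearMap.mk₂ ℝ (advH hm) (advH_add_left hm) (advH_smul_left hm) (advH_add_right hm)
      (advH_smul_right hm))
    (2 * advConst m * Sobolev.sumConst m) (norm_advH_le hm)

lemma adv_apply (hm : 1 < m) (v : FlowH m) (c : ScalarH m) : adv hm v c = advH hm v c := rfl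

@[simp] lemma coeff_adv (hm : 1 < m) (v : FlowH m) (c : ScalarH m) (k : Fin 2 → ℤ) :
    (adv hm v c).coeff k = advCoeff v c k := by
  rw [adv_apply, coeff_advH]

end AdvectionDiffusion

/-! ### The weak formulation, frequency by frequency -/

namespace AdvectionDiffusion

/-- The eigenvalues `4π²κ‖k‖²` of `-κΔ`. -/
def eigenval (κ : ℝ) (k : Fin 2 → ℤ) : ℝ := 4 * Real.pi ^ 2 * κ * freqNorm k ^ 2

lemma gradFun_congr {s t : ℝ} {c : ScalarH s} {d : ScalarH t} (h : ∀ k, c.coeff k = d.coeff k)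
    (j : Fin 2) : gradFun c j = gradFun d j := by
  rw [gradFun, gradFun]
  simp_rw [h]

lemma advection_congr {s t u : ℝ} (v : FlowH u) {c : ScalarH s} {d : ScalarH t}
    (h : ∀ k, c.coeff k = d.coeff k) : advection v c = advection v d := by
  funext x
  simp_rw [advection, gradFun_congr h]

lemma summable_mul_conj {s t : ℝ} (hs : 0 ≤ s) (ht : 0 ≤ t) (c : ScalarH s) (d : ScalarH t) :
    Summable fun k => c.coeff k * conj (d.coeff k) := by
  have h1 := (memℓp_gen_iff (by norm_num)).1 (Sobolev.memlp_coeff hs c)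
  have h2 := (memℓp_gen_iff (by norm_num)).1 (Sobolev.memlp_coeff ht d)
  refine Summable.of_norm_bounded (h1.add h2) fun k => ?_
  rw [norm_mul, RCLike.norm_conj, ENNReal.toReal_ofNat, Real.rpow_two, Real.rpow_two]
  nlinarith [sq_nonneg (‖c.coeff k‖ - ‖d.coeff k‖), sq_nonneg (‖c.coeff k‖ + ‖d.coeff k‖)]

lemma hasSum_integral_grad {s t : ℝ} (hs : 1 ≤ s) (ht : 1 ≤ t) (c : ScalarH s) (d : ScalarH t) :
    HasSum (fun k => (((4 * Real.pi ^ 2 * freqNorm k ^ 2 : ℝ) : ℂ) *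
        c.coeff k * conj (d.coeff k)).re)
      (∫ x, ∑ j, gradFun c j x * gradFun d j x ∂area) := by
  have h : ∀ j, HasSum (fun k => (gradCoeff c j k * conj (gradCoeff d j k)).re)
      (∫ x, gradFun c j x * gradFun d j x ∂area) := fun j => by
    have := integral_mul_fourierSeries (memLp_fourierSeries (gradCoeff c j))
      (memlp_gradCoeff ht d j) (conj_gradCoeff d j)
    simp_rw [fcoeff_fourierSeries (memlp_gradCoeff hs c j) (conj_gradCoeff c j)] at this
    exact this
  have hint : ∀ j ∈ (Finset.univ : Finset (Fin 2)),
      Integrable (fun x => gradFun c j x * gradFun d j x) area := fun j _ =>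
    (memLp_fourierSeries (gradCoeff c j)).integrable_mul (memLp_fourierSeries (gradCoeff d j))
  rw [integral_finsetSum _ hint]
  refine (hasSum_sum fun j _ => h j).congr_fun fun k => ?_
  rw [← Complex.re_sum]
  congr 1
  simp only [Fin.sum_univ_two, gradCoeff, map_mul, Complex.conj_ofReal, Complex.conj_I,
    map_intCast, map_ofNat, freqNorm_sq]
  push_cast
  linear_combination (4 * Real.pi ^ 2 * ((k 0 : ℂ) ^ 2 + (k 1 : ℂ) ^ 2) * c.coeff k *
    conj (d.coeff k)) * Complex.I_sq

variable {m : ℝ}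

/-- Parseval applied to each of the three terms. Here `c` and `c'` are the same function, seen in
`H^{m+1}` and in `H^m`. -/
lemma hasSum_weak_form (κ : ℝ) (hm : 1 < m) (v : FlowH m) (c : ScalarH (m + 1)) (c' : ScalarH m)
    (hc : ∀ k, c.coeff k = c'.coeff k) (d : ScalarH (m - 1)) (φ : ScalarH 1) :
    HasSum (fun k => ((d.coeff k + advCoeff v c' k + (eigenval κ k : ℂ) * c'.coeff k) *
        conj (φ.coeff k)).re)
      ((∑' k, d.coeff k * conj (φ.coeff k)).re
        + ∫ x, (∑ j, velocity v j x * gradFun c j x) * scalarFun φ x ∂area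
        + κ * ∫ x, ∑ j, gradFun c j x * gradFun φ j x ∂area) := by
  have h1 := Complex.hasSum_re
    (summable_mul_conj (by linarith) zero_le_one d φ).hasSum
  have h2 := integral_mul_fourierSeries (memLp_advection hm v c)
    (Sobolev.memlp_coeff zero_le_one φ) (conj_scalar_coeff φ)
  have h3 := (hasSum_integral_grad (by linarith) le_rfl c φ).mul_left κ
  have h4 : ∀ k, fcoeff (fun x => (advection v c x : ℂ)) k = advCoeff v c' k := fun k => by
    rw [advCoeff_eq_fcoeff hm, advection_congr v hc]
  simp_rw [h4] at h2
  refine ((h1.add h2).add h3).congr_fun fun k => ?_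
  rw [← hc, eigenval, add_mul, add_mul, Complex.add_re, Complex.add_re]
  congr 1
  rw [← Complex.re_ofReal_mul]
  congr 1
  push_cast
  ring

/-- The weak formulation at a fixed time is equivalent to the equation for each Fourier
coefficient. -/
lemma weak_form_iff (κ : ℝ) (hm : 1 < m) (v : FlowH m) (c : ScalarH (m + 1)) (c' : ScalarH m)
    (hc : ∀ k, c.coeff k = c'.coeff k) (d : ScalarH (m - 1)) :
    (∀ φ : ScalarH 1, (∑' k, d.coeff k * conj (φ.coeff k)).re
        + ∫ x, (∑ j, velocity v j x * gradFun c j x) * scalarFun φ x ∂area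
        + κ * ∫ x, ∑ j, gradFun c j x * gradFun φ j x ∂area = 0) ↔
      ∀ k, d.coeff k + advCoeff v c' k + (eigenval κ k : ℂ) * c'.coeff k = 0 := by
  classical
  constructor
  · intro h l
    set R : (Fin 2 → ℤ) → ℂ := fun k =>
      d.coeff k + advCoeff v c' k + (eigenval κ k : ℂ) * c'.coeff k with hR
    have hRc : ∀ k, conj (R k) = R (-k) := fun k => by
      simp only [hR, map_add, map_mul, Complex.conj_ofReal, conj_scalar_coeff, conj_advCoeff,
        eigenval, freqNorm_neg]
    have hR0 : R 0 = 0 := by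
      have := (advH hm v c').coeff_zero_freq
      rw [coeff_advH] at this
      simp [hR, this]
    -- A real test function needs a symmetric set of frequencies. Testing with the residual `R`
    -- itself, cut off to `±l`, turns the weak form into a sum of squares equal to 0.
    set S : Finset (Fin 2 → ℤ) := {l, -l} with hS
    have hSneg : ∀ k, -k ∈ S ↔ k ∈ S := fun k => by
      simp only [hS, Finset.mem_insert, Finset.mem_singleton, neg_eq_iff_eq_neg, neg_neg]
      exact or_comm
    set φ : ScalarH 1 := Sobolev.ofCoeff (fun k => if k ∈ S then R k else 0)
      (by simp [hR0])
      (fun k => by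
        simp only [hSneg, Complex.ofReal_one, one_mul]
        split_ifs
        · exact hRc k
        · simp)
      (summable_of_ne_finset_zero (s := S) fun k hk => by simp [hk]) with hφ
    have h1 := hasSum_weak_form κ hm v c c' hc d φ
    rw [h φ] at h1
    have h2 : ∀ k, ((d.coeff k + advCoeff v c' k + (eigenval κ k : ℂ) * c'.coeff k) *
        conj (φ.coeff k)).re = if k ∈ S then ‖R k‖ ^ 2 else 0 := fun k => by
      simp only [hφ, Sobolev.coeff_ofCoeff]
      split_ifs
      · change (R k * conj (R k)).re = _
        rw [Complex.mul_conj, Complex.ofReal_re, Complex.normSq_eq_norm_sq]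
      · simp
    simp_rw [h2] at h1
    have h5 : ∀ k, 0 ≤ if k ∈ S then ‖R k‖ ^ 2 else 0 := fun k => by
      split_ifs
      · positivity
      · exact le_rfl
    have h3 := (hasSum_zero_iff_of_nonneg h5).1 h1
    have h4 := congrFun h3 l
    simpa [hS] using h4
  · intro h φ
    refine (hasSum_weak_form κ hm v c c' hc d φ).unique ?_
    simp_rw [h]
    simp

end AdvectionDiffusion

/-! ### The scalar equation `y' + λ y = f` -/

namespace AdvectionDiffusion

/-- The solution of `y' + λ y = f`, `y(0) = a`. -/
def relax (l : ℝ) (a : ℂ) (f : ℝ → ℂ) (t : ℝ) : ℂ :=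
  Complex.exp (-(l * t : ℝ)) * (a + ∫ s in (0 : ℝ)..t, Complex.exp ((l * s : ℝ)) * f s)

variable {l : ℝ} {a : ℂ} {f : ℝ → ℂ}

lemma relax_zero : relax l a f 0 = a := by simp [relax]

lemma hasDerivAt_exp_mul (l t : ℝ) :
    HasDerivAt (fun s : ℝ => Complex.exp ((l * s : ℝ))) (l * Complex.exp ((l * t : ℝ))) t := by
  have h1 : HasDerivAt (fun s : ℝ => ((l * s : ℝ) : ℂ)) (l : ℂ) t := by
    have := ((hasDerivAt_id t).const_mul l).ofReal_comp
    simpa using this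
  simpa [mul_comm] using h1.cexp

lemma hasDerivAt_relax (hf : Continuous f) (t : ℝ) :
    HasDerivAt (relax l a f) (f t - l * relax l a f t) t := by
  have h1 : HasDerivAt (fun s : ℝ => Complex.exp (-(l * s : ℝ)))
      (-l * Complex.exp (-(l * t : ℝ))) t := by
    have := hasDerivAt_exp_mul (-l) t
    simpa using this
  have hg : Continuous fun s : ℝ => Complex.exp ((l * s : ℝ)) * f s := by fun_prop
  have h2 : HasDerivAt (fun t => a + ∫ s in (0 : ℝ)..t, Complex.exp ((l * s : ℝ)) * f s)
      (Complex.exp ((l * t : ℝ)) * f t) t :=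
    (intervalIntegral.integral_hasDerivAt_right (hg.intervalIntegrable _ _)
      hg.stronglyMeasurable.stronglyMeasurableAtFilter hg.continuousAt).const_add a
  have h3 := h1.mul h2
  have h4 : Complex.exp (-(l * t : ℝ)) * Complex.exp ((l * t : ℝ)) = 1 := by
    rw [← Complex.exp_add]; simp
  refine h3.congr_deriv ?_
  rw [relax, ← mul_assoc (Complex.exp (-(l * t : ℝ))), h4]
  ring

lemma continuous_relax (hf : Continuous f) : Continuous (relax l a f) :=
  continuous_iff_continuousAt.2 fun t => (hasDerivAt_relax hf t).continuousAt

/-- The energy estimate for `y' + λ y = f`. -/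
lemma relax_energy (hl : 0 < l) (hf : Continuous f) {t : ℝ} (ht : 0 ≤ t) :
    ‖relax l a f t‖ ^ 2 + l * ∫ s in (0 : ℝ)..t, ‖relax l a f s‖ ^ 2 ≤
      ‖a‖ ^ 2 + l⁻¹ * ∫ s in (0 : ℝ)..t, ‖f s‖ ^ 2 := by
  set y := relax l a f with hy
  have hyc : Continuous y := continuous_relax hf
  have hprim : ∀ {g : ℝ → ℝ}, Continuous g → ∀ t,
      HasDerivAt (fun t => ∫ s in (0 : ℝ)..t, g s) (g t) t := fun {g} hg t =>
    intervalIntegral.integral_hasDerivAt_right (hg.intervalIntegrable _ _)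
      hg.stronglyMeasurable.stronglyMeasurableAtFilter hg.continuousAt
  -- The claim is `E t ≤ E 0`; it follows from `E' ≤ -l⁻¹ (l‖y‖ - ‖f‖)² ≤ 0`.
  set E : ℝ → ℝ := fun t => ‖y t‖ ^ 2 + l * (∫ s in (0 : ℝ)..t, ‖y s‖ ^ 2) -
    l⁻¹ * ∫ s in (0 : ℝ)..t, ‖f s‖ ^ 2 with hE
  have hd : ∀ t, HasDerivAt E
      (2 * inner ℝ (y t) (f t - l * y t) + l * ‖y t‖ ^ 2 - l⁻¹ * ‖f t‖ ^ 2) t := fun t =>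
    (((hasDerivAt_relax hf t).norm_sq).add
      ((hprim (g := fun s => ‖y s‖ ^ 2) (by fun_prop) t).const_mul l)).sub
      ((hprim (g := fun s => ‖f s‖ ^ 2) (by fun_prop) t).const_mul l⁻¹)
  have hanti : Antitone E := by
    refine antitone_of_deriv_nonpos (fun t => (hd t).differentiableAt) fun t => ?_
    rw [(hd t).deriv]
    have h1 : inner ℝ (y t) (f t - l * y t) = inner ℝ (y t) (f t) - l * ‖y t‖ ^ 2 := by
      rw [inner_sub_right, ← Complex.real_smul, inner_smul_right, real_inner_self_eq_norm_sq]
    have h2 := real_inner_le_norm (y t) (f t)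
    have h3 : 0 ≤ l⁻¹ * (l * ‖y t‖ - ‖f t‖) ^ 2 := by positivity
    have h4 : l⁻¹ * (l * ‖y t‖ - ‖f t‖) ^ 2 =
        l * ‖y t‖ ^ 2 - 2 * (‖y t‖ * ‖f t‖) + l⁻¹ * ‖f t‖ ^ 2 := by
      field_simp
      ring
    rw [h1]
    linarith
  have h := hanti ht
  have h0 : E 0 = ‖a‖ ^ 2 := by simp [hE, hy, relax_zero]
  rw [h0] at h
  simp only [hE] at h
  linarith

/-- Uniqueness: a solution of the integrated equation on `[0, t]` is `relax`. -/
lemma eq_relax (hf : Continuous f) {y : ℝ → ℂ} (hy : Continuous y) {T : ℝ}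
    (h : ∀ t ∈ Icc 0 T, y t = a + ∫ s in (0 : ℝ)..t, (f s - l * y s)) {t : ℝ}
    (ht : t ∈ Icc 0 T) : y t = relax l a f t := by
  set g : ℝ → ℂ := fun s => f s - l * y s with hg
  have hgc : Continuous g := by fun_prop
  -- The equation for `y` is known only on `[0, T]`; `z` agrees with `y` there and is differentiable
  -- on the whole line, so there are no one-sided derivatives at the endpoints.
  set z : ℝ → ℂ := fun t => a + ∫ s in (0 : ℝ)..t, g s with hz
  have hzd : ∀ t, HasDerivAt z (g t) t := fun t =>
    (intervalIntegral.integral_hasDerivAt_right (hgc.intervalIntegrable _ _)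
      hgc.stronglyMeasurable.stronglyMeasurableAtFilter hgc.continuousAt).const_add a
  have hd : ∀ s ∈ uIcc 0 t, HasDerivAt (fun s : ℝ => Complex.exp ((l * s : ℝ)) * z s)
      (Complex.exp ((l * s : ℝ)) * f s) s := by
    intro s hs
    rw [uIcc_of_le ht.1] at hs
    have h1 := (hasDerivAt_exp_mul l s).mul (hzd s)
    refine h1.congr_deriv ?_
    have h2 : z s = y s := (h s ⟨hs.1, hs.2.trans ht.2⟩).symm
    rw [h2, hg]
    ring
  have hint : IntervalIntegrable (fun s : ℝ => Complex.exp ((l * s : ℝ)) * f s) volume 0 t := by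
    apply Continuous.intervalIntegrable
    fun_prop
  have h3 := intervalIntegral.integral_eq_sub_of_hasDerivAt hd hint
  have hz0 : z 0 = a := by simp [hz]
  have h4 : Complex.exp (-(l * t : ℝ)) * Complex.exp ((l * t : ℝ)) = 1 := by
    rw [← Complex.exp_add]; simp
  rw [relax, h3, hz0]
  simp only [mul_zero, Complex.ofReal_zero, Complex.exp_zero, one_mul, add_sub_cancel]
  rw [← mul_assoc, h4, one_mul]
  exact h t ht

lemma relax_integral_eq (hf : Continuous f) (t : ℝ) :
    relax l a f t = a + ∫ s in (0 : ℝ)..t, (f s - l * relax l a f s) := by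
  have hc := continuous_relax (l := l) (a := a) hf
  rw [intervalIntegral.integral_eq_sub_of_hasDerivAt (fun s _ => hasDerivAt_relax hf s)
    (Continuous.intervalIntegrable (by fun_prop) _ _), relax_zero]
  ring

end AdvectionDiffusion

/-! ### Mild solutions of the heat equation with a source -/

namespace AdvectionDiffusion

lemma relax_add {l : ℝ} {a b : ℂ} {f g : ℝ → ℂ} (hf : Continuous f) (hg : Continuous g) (t : ℝ) :
    relax l (a + b) (fun s => f s + g s) t = relax l a f t + relax l b g t := by
  simp only [relax, mul_add]
  rw [intervalIntegral.integral_add (Continuous.intervalIntegrable (by fun_prop) _ _)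
    (Continuous.intervalIntegrable (by fun_prop) _ _)]
  ring

lemma relax_const_mul {l : ℝ} (r a : ℂ) (f : ℝ → ℂ) (t : ℝ) :
    relax l (r * a) (fun s => r * f s) t = r * relax l a f t := by
  simp only [relax]
  simp_rw [mul_left_comm _ r]
  rw [intervalIntegral.integral_const_mul]
  ring

lemma conj_relax (l : ℝ) (a : ℂ) (f : ℝ → ℂ) (t : ℝ) :
    conj (relax l a f t) = relax l (conj a) (fun s => conj (f s)) t := by
  simp only [relax, map_mul, map_add, ← Complex.exp_conj, map_neg, Complex.conj_ofReal]
  congr 2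
  rw [intervalIntegral, intervalIntegral, map_sub, ← integral_conj, ← integral_conj]
  simp only [map_mul, ← Complex.exp_conj, Complex.conj_ofReal]

/-- Continuous curves in `H^s`, on the time interval `[0, T]`. -/
abbrev Curve (T s : ℝ) : Type := C(Icc (0 : ℝ) T, ScalarH s)

/-- The extension of a curve to the real line which is constant outside of `[0, T]`. -/
def extend {T s : ℝ} (hT : 0 ≤ T) (f : Curve T s) : ℝ → ScalarH s := IccExtend hT f

section Extend

variable {T s : ℝ} (hT : 0 ≤ T)

lemma continuous_extend (f : Curve T s) : Continuous (extend hT f) := f.continuous.Icc_extend'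

lemma extend_of_mem (f : Curve T s) {t : ℝ} (ht : t ∈ Icc 0 T) : extend hT f t = f ⟨t, ht⟩ :=
  IccExtend_of_mem hT f ht

lemma norm_extend_le (f : Curve T s) (t : ℝ) : ‖extend hT f t‖ ≤ ‖f‖ :=
  f.norm_coe_le_norm _

lemma continuous_coeff_extend (f : Curve T s) (k : Fin 2 → ℤ) :
    Continuous fun t => (extend hT f t).coeff k :=
  (Sobolev.continuous_coeff k).comp (continuous_extend hT f)

end Extend

variable {κ T m : ℝ}

lemma eigenval_pos (hκ : 0 < κ) {k : Fin 2 → ℤ} (hk : k ≠ 0) : 0 < eigenval κ k := by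
  have := freqNorm_pos hk
  have := Real.pi_pos
  unfold eigenval
  positivity

/-- The coefficients of the mild solution of `y' = κΔy + f`, `y(0) = a`. -/
def mildCoeff (κ : ℝ) (hT : 0 ≤ T) (a : ScalarH m) (f : Curve T (m - 1)) (t : ℝ)
    (k : Fin 2 → ℤ) : ℂ :=
  relax (eigenval κ k) (a.coeff k) (fun s => (extend hT f s).coeff k) t


lemma mildCoeff_zero_freq (hT : 0 ≤ T) (a : ScalarH m) (f : Curve T (m - 1)) (t : ℝ) : mildCoeff κ hT a f t 0 = 0 := by
  simp [mildCoeff, relax]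

lemma conj_mildCoeff (hT : 0 ≤ T) (a : ScalarH m) (f : Curve T (m - 1)) (t : ℝ) (k : Fin 2 → ℤ) :
    conj (mildCoeff κ hT a f t k) = mildCoeff κ hT a f t (-k) := by
  simp only [mildCoeff, conj_relax, conj_scalar_coeff, eigenval, freqNorm_neg]

lemma continuous_mildCoeff (hT : 0 ≤ T) (a : ScalarH m) (f : Curve T (m - 1)) (k : Fin 2 → ℤ) : Continuous fun t => mildCoeff κ hT a f t k :=
  continuous_relax (continuous_coeff_extend hT f k)

/-- The constant `(4π²κ)⁻¹`. -/
def heatConst (κ : ℝ) : ℝ := (4 * Real.pi ^ 2 * κ)⁻¹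

lemma heatConst_pos (hκ : 0 < κ) : 0 < heatConst κ := by
  unfold heatConst
  have := Real.pi_pos
  positivity

/-- This is `relax_energy` multiplied by `‖k‖^{2m}`. As `λ_k` is proportional to `‖k‖²`, the
dissipation controls `H^{m+1}` and the source is needed only in `H^{m-1}`: this regains the
derivative lost by advection. -/
lemma mildCoeff_energy (hκ : 0 < κ) (hT : 0 ≤ T) (a : ScalarH m) (f : Curve T (m - 1)) {t : ℝ} (ht : 0 ≤ t) (k : Fin 2 → ℤ) :
    freqNorm k ^ (2 * m) * ‖mildCoeff κ hT a f t k‖ ^ 2 + (heatConst κ)⁻¹ *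
        ∫ s in (0 : ℝ)..t, freqNorm k ^ (2 * (m + 1)) * ‖mildCoeff κ hT a f s k‖ ^ 2 ≤
      freqNorm k ^ (2 * m) * ‖a.coeff k‖ ^ 2 + heatConst κ *
        ∫ s in (0 : ℝ)..t, freqNorm k ^ (2 * (m - 1)) * ‖(extend hT f s).coeff k‖ ^ 2 := by
  by_cases hk : k = 0
  · subst hk
    simp [mildCoeff_zero_freq]
  · have hp := freqNorm_pos hk
    have h := relax_energy (a := a.coeff k) (eigenval_pos hκ hk)
      (continuous_coeff_extend hT f k) ht
    have h2 := mul_le_mul_of_nonneg_left h (freqNorm_rpow_nonneg k (2 * m))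
    rw [intervalIntegral.integral_const_mul, intervalIntegral.integral_const_mul]
    have e1 : freqNorm k ^ (2 * (m + 1)) = freqNorm k ^ (2 * m) * freqNorm k ^ 2 := by
      rw [mul_add, Real.rpow_add hp]
      norm_num
    have e2 : freqNorm k ^ (2 * (m - 1)) = freqNorm k ^ (2 * m) * (freqNorm k ^ 2)⁻¹ := by
      rw [mul_sub, Real.rpow_sub hp, div_eq_mul_inv]
      norm_num
    rw [e1, e2]
    unfold eigenval at h2
    rw [mul_inv] at h2
    unfold heatConst
    rw [inv_inv]
    unfold mildCoeff eigenval
    linarith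

lemma sum_mildCoeff_energy (hκ : 0 < κ) (hT : 0 ≤ T) (a : ScalarH m) (f : Curve T (m - 1)) {t : ℝ} (ht : 0 ≤ t) (F : Finset (Fin 2 → ℤ)) :
    ∑ k ∈ F, freqNorm k ^ (2 * m) * ‖mildCoeff κ hT a f t k‖ ^ 2 + (heatConst κ)⁻¹ *
        ∑ k ∈ F, ∫ s in (0 : ℝ)..t,
          freqNorm k ^ (2 * (m + 1)) * ‖mildCoeff κ hT a f s k‖ ^ 2 ≤
      ‖a‖ ^ 2 + heatConst κ * ∫ s in (0 : ℝ)..t, ‖extend hT f s‖ ^ 2 := by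
  have hf := continuous_extend hT f
  have h1 := Finset.sum_le_sum fun k (_ : k ∈ F) => mildCoeff_energy hκ hT a f ht k
  rw [Finset.sum_add_distrib, Finset.sum_add_distrib, ← Finset.mul_sum, ← Finset.mul_sum] at h1
  refine h1.trans (add_le_add (a.sum_le_norm_sq F) ?_)
  refine mul_le_mul_of_nonneg_left ?_ (heatConst_pos hκ).le
  have hk : ∀ k, Continuous fun s =>
      freqNorm k ^ (2 * (m - 1)) * ‖(extend hT f s).coeff k‖ ^ 2 := fun k =>
    continuous_const.mul ((continuous_coeff_extend hT f k).norm.pow 2)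
  rw [← intervalIntegral.integral_finsetSum fun k _ => (hk k).intervalIntegrable _ _]
  exact intervalIntegral.integral_mono_on ht
    ((continuous_finsetSum F fun k _ => hk k).intervalIntegrable _ _)
    ((hf.norm.pow 2).intervalIntegrable _ _) fun s _ => (extend hT f s).sum_le_norm_sq F

lemma sum_mildCoeff_le (hκ : 0 < κ) (hT : 0 ≤ T) (a : ScalarH m) (f : Curve T (m - 1)) {t : ℝ} (ht : 0 ≤ t) (F : Finset (Fin 2 → ℤ)) :
    ∑ k ∈ F, freqNorm k ^ (2 * m) * ‖mildCoeff κ hT a f t k‖ ^ 2 ≤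
      ‖a‖ ^ 2 + heatConst κ * ∫ s in (0 : ℝ)..t, ‖extend hT f s‖ ^ 2 := by
  refine le_trans (le_add_of_nonneg_right ?_) (sum_mildCoeff_energy hκ hT a f ht F)
  refine mul_nonneg (inv_nonneg.2 (heatConst_pos hκ).le) (Finset.sum_nonneg fun k _ => ?_)
  exact intervalIntegral.integral_nonneg ht fun s _ => Sobolev.weight_nonneg _ _ _

lemma sum_integral_mildCoeff_le (hκ : 0 < κ) (hT : 0 ≤ T) (a : ScalarH m) (f : Curve T (m - 1)) (F : Finset (Fin 2 → ℤ)) :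
    ∑ k ∈ F, ∫ s in (0 : ℝ)..T, freqNorm k ^ (2 * (m + 1)) * ‖mildCoeff κ hT a f s k‖ ^ 2 ≤
      heatConst κ *
        (‖a‖ ^ 2 + heatConst κ * ∫ s in (0 : ℝ)..T, ‖extend hT f s‖ ^ 2) := by
  have h := sum_mildCoeff_energy hκ hT a f hT F
  have h0 : 0 ≤ ∑ k ∈ F, freqNorm k ^ (2 * m) * ‖mildCoeff κ hT a f T k‖ ^ 2 :=
    Finset.sum_nonneg fun k _ => Sobolev.weight_nonneg _ _ _
  have hc := heatConst_pos hκ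
  rw [← inv_mul_le_iff₀ hc]
  linarith

/-- The value at a given time of the mild solution of `y' = κΔy + f`, `y(0) = a`. -/
def mildAt (hκ : 0 < κ) (hT : 0 ≤ T) (a : ScalarH m) (f : Curve T (m - 1))
    (t : Icc (0 : ℝ) T) : ScalarH m :=
  Sobolev.ofCoeff (mildCoeff κ hT a f t) (mildCoeff_zero_freq hT a f t)
    (fun k => by rw [conj_mildCoeff, Complex.ofReal_one, one_mul])
    (summable_of_sum_le (fun k => Sobolev.weight_nonneg _ _ _)
      (sum_mildCoeff_le hκ hT a f t.2.1))

lemma coeff_mildAt (hκ : 0 < κ) (hT : 0 ≤ T) (a : ScalarH m) (f : Curve T (m - 1)) (t : Icc (0 : ℝ) T) (k : Fin 2 → ℤ) :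
    (mildAt hκ hT a f t).coeff k = mildCoeff κ hT a f t k := rfl

lemma norm_mildAt_sq_le (hκ : 0 < κ) (hT : 0 ≤ T) (a : ScalarH m) (f : Curve T (m - 1)) (t : Icc (0 : ℝ) T) : ‖mildAt hκ hT a f t‖ ^ 2 ≤
    ‖a‖ ^ 2 + heatConst κ * ∫ s in (0 : ℝ)..t, ‖extend hT f s‖ ^ 2 :=
  Sobolev.norm_sq_le (sum_mildCoeff_le hκ hT a f t.2.1)

/-- For each frequency the energy bound with the source integrated up to `T` is independent of `t`,
and these bounds are summable over the frequencies; dominated convergence applies. -/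
lemma continuous_mildAt (hκ : 0 < κ) (hT : 0 ≤ T) (a : ScalarH m) (f : Curve T (m - 1)) : Continuous (mildAt hκ hT a f) := by
  have hk : ∀ k, Continuous fun s =>
      freqNorm k ^ (2 * (m - 1)) * ‖(extend hT f s).coeff k‖ ^ 2 := fun k =>
    continuous_const.mul ((continuous_coeff_extend hT f k).norm.pow 2)
  refine Sobolev.continuous_of_dominated
    (fun k => (continuous_mildCoeff hT a f k).comp continuous_subtype_val)
    (b := fun k => freqNorm k ^ (2 * m) * ‖a.coeff k‖ ^ 2 + heatConst κ *
      ∫ s in (0 : ℝ)..T, freqNorm k ^ (2 * (m - 1)) * ‖(extend hT f s).coeff k‖ ^ 2) ?_ ?_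
  · refine a.summable_coeff.add (Summable.mul_left _ ?_)
    refine summable_of_sum_le (c := ∫ s in (0 : ℝ)..T, ‖extend hT f s‖ ^ 2)
      (fun k => intervalIntegral.integral_nonneg hT fun s _ => Sobolev.weight_nonneg _ _ _)
      fun F => ?_
    rw [← intervalIntegral.integral_finsetSum fun k _ => (hk k).intervalIntegrable _ _]
    exact intervalIntegral.integral_mono_on hT
      ((continuous_finsetSum F fun k _ => hk k).intervalIntegrable _ _)
      (((continuous_extend hT f).norm.pow 2).intervalIntegrable _ _)
      fun s _ => (extend hT f s).sum_le_norm_sq F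
  · intro k t
    have h1 := mildCoeff_energy hκ hT a f t.2.1 k
    have h2 : 0 ≤ (heatConst κ)⁻¹ * ∫ s in (0 : ℝ)..t,
        freqNorm k ^ (2 * (m + 1)) * ‖mildCoeff κ hT a f s k‖ ^ 2 :=
      mul_nonneg (inv_nonneg.2 (heatConst_pos hκ).le)
        (intervalIntegral.integral_nonneg t.2.1 fun s _ => Sobolev.weight_nonneg _ _ _)
    have h3 : ∫ s in (0 : ℝ)..t, freqNorm k ^ (2 * (m - 1)) * ‖(extend hT f s).coeff k‖ ^ 2 ≤
        ∫ s in (0 : ℝ)..T, freqNorm k ^ (2 * (m - 1)) * ‖(extend hT f s).coeff k‖ ^ 2 :=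
      intervalIntegral.integral_mono_interval le_rfl t.2.1 t.2.2
        (Filter.Eventually.of_forall fun s => Sobolev.weight_nonneg _ _ _)
        ((hk k).intervalIntegrable _ _)
    have h4 := mul_le_mul_of_nonneg_left h3 (heatConst_pos hκ).le
    rw [coeff_mildAt]
    linarith

/-- The mild solution of `y' = κΔy + f`, `y(0) = a`, as a curve in `H^m`. -/
def mild (hκ : 0 < κ) (hT : 0 ≤ T) (a : ScalarH m) (f : Curve T (m - 1)) : Curve T m :=
  ⟨mildAt hκ hT a f, continuous_mildAt hκ hT a f⟩

lemma coeff_mild (hκ : 0 < κ) (hT : 0 ≤ T) (a : ScalarH m) (f : Curve T (m - 1)) (t : Icc (0 : ℝ) T) (k : Fin 2 → ℤ) :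
    (mild hκ hT a f t).coeff k = mildCoeff κ hT a f t k := rfl

lemma coeff_extend_add (hT : 0 ≤ T) {s : ℝ} (f g : Curve T s) (t : ℝ) (k : Fin 2 → ℤ) :
    (extend hT (f + g) t).coeff k = (extend hT f t).coeff k + (extend hT g t).coeff k := rfl

lemma coeff_extend_smul (hT : 0 ≤ T) {s : ℝ} (r : ℝ) (f : Curve T s) (t : ℝ) (k : Fin 2 → ℤ) :
    (extend hT (r • f) t).coeff k = (r : ℂ) * (extend hT f t).coeff k :=
  Sobolev.coeff_smul r (extend hT f t) k

lemma mild_add (hκ : 0 < κ) (hT : 0 ≤ T) (a b : ScalarH m) (f g : Curve T (m - 1)) :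
    mild hκ hT (a + b) (f + g) = mild hκ hT a f + mild hκ hT b g := by
  refine ContinuousMap.ext fun t => Sobolev.ext fun k => ?_
  rw [ContinuousMap.add_apply, Sobolev.coeff_add, coeff_mild, coeff_mild, coeff_mild]
  simp only [mildCoeff, Sobolev.coeff_add, coeff_extend_add]
  exact relax_add (continuous_coeff_extend hT f k) (continuous_coeff_extend hT g k) t

lemma mild_smul (hκ : 0 < κ) (hT : 0 ≤ T) (r : ℝ) (a : ScalarH m) (f : Curve T (m - 1)) :
    mild hκ hT (r • a) (r • f) = r • mild hκ hT a f := by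
  refine ContinuousMap.ext fun t => Sobolev.ext fun k => ?_
  rw [ContinuousMap.smul_apply, Sobolev.coeff_smul, coeff_mild, coeff_mild]
  simp only [mildCoeff, Sobolev.coeff_smul, coeff_extend_smul]
  exact relax_const_mul _ _ _ t

lemma norm_mild_zero_apply_sq_le (hκ : 0 < κ) (hT : 0 ≤ T) (f : Curve T (m - 1))
    (t : Icc (0 : ℝ) T) :
    ‖mild hκ hT 0 f t‖ ^ 2 ≤ heatConst κ * ∫ s in (0 : ℝ)..t, ‖extend hT f s‖ ^ 2 := by
  have h := norm_mildAt_sq_le hκ hT 0 f t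
  rw [norm_zero, zero_pow two_ne_zero, zero_add] at h
  exact h

lemma norm_mild_zero_le (hκ : 0 < κ) (hT : 0 ≤ T) (f : Curve T (m - 1)) :
    ‖mild hκ hT 0 f‖ ≤ Real.sqrt (heatConst κ * T) * ‖f‖ := by
  have hc := heatConst_pos hκ
  refine (ContinuousMap.norm_le _ (by positivity)).2 fun t => ?_
  have h := norm_mild_zero_apply_sq_le hκ hT f t
  have h1 : ∫ s in (0 : ℝ)..t, ‖extend hT f s‖ ^ 2 ≤ ∫ _ in (0 : ℝ)..t, ‖f‖ ^ 2 :=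
    intervalIntegral.integral_mono_on t.2.1
      (((continuous_extend hT f).norm.pow 2).intervalIntegrable _ _)
      (by simp) fun s _ => pow_le_pow_left₀ (norm_nonneg _) (norm_extend_le hT f s) 2
  rw [intervalIntegral.integral_const, sub_zero, smul_eq_mul] at h1
  have h2 : (t : ℝ) * ‖f‖ ^ 2 ≤ T * ‖f‖ ^ 2 :=
    mul_le_mul_of_nonneg_right t.2.2 (sq_nonneg _)
  refine (sq_le_sq₀ (norm_nonneg _) (by positivity)).1 ?_
  rw [mul_pow, Real.sq_sqrt (by positivity), mul_assoc]
  exact h.trans (mul_le_mul_of_nonneg_left (h1.trans h2) hc.le)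

/-- The solution operator of the heat equation with source, for zero initial data. -/
def duhamel (hκ : 0 < κ) (hT : 0 ≤ T) : Curve T (m - 1) →L[ℝ] Curve T m :=
  LinearMap.mkContinuous
    { toFun := mild hκ hT 0
      map_add' := fun f g => by
        have := mild_add hκ hT (0 : ScalarH m) 0 f g
        rwa [add_zero] at this
      map_smul' := fun r f => by
        have := mild_smul hκ hT r (0 : ScalarH m) f
        rwa [smul_zero] at this }
    (Real.sqrt (heatConst κ * T)) (norm_mild_zero_le hκ hT)

lemma duhamel_apply (hκ : 0 < κ) (hT : 0 ≤ T) (f : Curve T (m - 1)) :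
    duhamel hκ hT f = mild hκ hT 0 f := rfl

/-! ### Advection-diffusion as a Volterra equation -/

/-- The advection term along a curve. -/
def advCurve (hm : 1 < m) (v : FlowH m) : Curve T m →L[ℝ] Curve T (m - 1) :=
  (adv hm v).compLeftContinuous ℝ (Icc (0 : ℝ) T)

@[simp] lemma advCurve_apply (hm : 1 < m) (v : FlowH m) (x : Curve T m) (t : Icc (0 : ℝ) T) :
    advCurve hm v x t = adv hm v (x t) := rfl

lemma extend_advCurve (hm : 1 < m) (hT : 0 ≤ T) (v : FlowH m) (x : Curve T m) (t : ℝ) :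
    extend hT (advCurve hm v x) t = adv hm v (extend hT x t) := rfl

/-- The Volterra operator whose fixed point equation is the advection-diffusion equation. -/
def volterra (hκ : 0 < κ) (hT : 0 ≤ T) (hm : 1 < m) (v : FlowH m) : Curve T m →L[ℝ] Curve T m :=
  -((duhamel hκ hT).comp (advCurve hm v))

section Volterra

variable (hκ : 0 < κ) (hT : 0 ≤ T) (hm : 1 < m)

lemma volterra_apply (v : FlowH m) (x : Curve T m) :
    volterra hκ hT hm v x = -mild hκ hT 0 (advCurve hm v x) := rfl

/-- The integral up to `t` is kept instead of a supremum over `[0, T]`: iterating it produces the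
factorial in `norm_volterra_pow_apply_sq_le`, whatever the sizes of `T` and `v`. -/
lemma norm_volterra_apply_sq_le (v : FlowH m) (x : Curve T m) (t : Icc (0 : ℝ) T) :
    ‖volterra hκ hT hm v x t‖ ^ 2 ≤
      heatConst κ * ‖adv hm v‖ ^ 2 * ∫ s in (0 : ℝ)..t, ‖extend hT x s‖ ^ 2 := by
  rw [volterra_apply, ContinuousMap.neg_apply, norm_neg]
  refine (norm_mild_zero_apply_sq_le hκ hT _ t).trans ?_
  rw [mul_assoc, ← intervalIntegral.integral_const_mul (‖adv hm v‖ ^ 2)]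
  refine mul_le_mul_of_nonneg_left ?_ (heatConst_pos hκ).le
  refine intervalIntegral.integral_mono_on t.2.1
    (((continuous_extend hT _).norm.pow 2).intervalIntegrable _ _)
    ((((continuous_extend hT x).norm.pow 2).const_mul _).intervalIntegrable _ _) fun s _ => ?_
  rw [← mul_pow, extend_advCurve]
  exact pow_le_pow_left₀ (norm_nonneg _) ((adv hm v).le_opNorm _) 2

lemma norm_volterra_pow_apply_sq_le (v : FlowH m) (x : Curve T m) (n : ℕ) (t : Icc (0 : ℝ) T) :
    ‖(volterra hκ hT hm v ^ n) x t‖ ^ 2 ≤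
      (heatConst κ * ‖adv hm v‖ ^ 2 * t) ^ n / n.factorial * ‖x‖ ^ 2 := by
  induction n generalizing t with
  | zero =>
    simpa using pow_le_pow_left₀ (norm_nonneg _) (x.norm_coe_le_norm t) 2
  | succ n ih =>
    set A := heatConst κ * ‖adv hm v‖ ^ 2 with hA
    have hA0 : 0 ≤ A := mul_nonneg (heatConst_pos hκ).le (sq_nonneg _)
    have h0 := norm_volterra_apply_sq_le hκ hT hm v ((volterra hκ hT hm v ^ n) x) t
    rw [pow_succ' (volterra hκ hT hm v)]
    refine h0.trans ?_
    have h1 : ∫ s in (0 : ℝ)..t, ‖extend hT ((volterra hκ hT hm v ^ n) x) s‖ ^ 2 ≤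
        ∫ s in (0 : ℝ)..t, A ^ n / n.factorial * ‖x‖ ^ 2 * s ^ n := by
      refine intervalIntegral.integral_mono_on t.2.1
        (((continuous_extend hT _).norm.pow 2).intervalIntegrable _ _)
        (Continuous.intervalIntegrable (by fun_prop) _ _) fun s hs => ?_
      have hs' : s ∈ Icc 0 T := ⟨hs.1, hs.2.trans t.2.2⟩
      rw [extend_of_mem hT _ hs']
      refine (ih ⟨s, hs'⟩).trans (le_of_eq ?_)
      rw [mul_pow]
      ring
    refine (mul_le_mul_of_nonneg_left h1 hA0).trans (le_of_eq ?_)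
    rw [intervalIntegral.integral_const_mul, integral_pow, Nat.factorial_succ]
    push_cast
    have : (n.factorial : ℝ) ≠ 0 := by positivity
    have : (n : ℝ) + 1 ≠ 0 := by positivity
    field_simp
    ring

lemma exists_norm_volterra_pow_lt_one (v : FlowH m) :
    ∃ n, ‖volterra hκ hT hm v ^ n‖ < 1 := by
  set A := heatConst κ * ‖adv hm v‖ ^ 2 with hA
  have hA0 : 0 ≤ A := mul_nonneg (heatConst_pos hκ).le (sq_nonneg _)
  have h := FloorSemiring.tendsto_pow_div_factorial_atTop (A * T)
  -- The estimate is for squared norms, so `1/4` here gives operator norm at most `1/2`.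
  obtain ⟨n, hn⟩ := ((h.eventually (gt_mem_nhds (show (0 : ℝ) < 1 / 4 by norm_num)))).exists
  refine ⟨n, lt_of_le_of_lt (ContinuousLinearMap.opNorm_le_bound _ (M := 1 / 2) (by norm_num)
    fun x => ?_) (by norm_num)⟩
  refine (ContinuousMap.norm_le _ (by positivity)).2 fun t => ?_
  refine (sq_le_sq₀ (norm_nonneg _) (by positivity)).1 ?_
  refine (norm_volterra_pow_apply_sq_le hκ hT hm v x n t).trans ?_
  rw [mul_pow (1 / 2) ‖x‖]
  refine mul_le_mul_of_nonneg_right ?_ (sq_nonneg _)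
  have h2 : (A * t) ^ n / n.factorial ≤ (A * T) ^ n / n.factorial := by
    have h3 := t.2.1
    have h4 := t.2.2
    gcongr
  exact h2.trans (hn.le.trans (by norm_num))

/-- With `K` the Volterra operator and `‖K^n‖ < 1`, the unit `1 - K^n` is the product of `1 - K` and
the commuting geometric sum, so `1 - K` is itself a unit. -/
lemma isUnit_one_sub_volterra (v : FlowH m) : IsUnit (1 - volterra hκ hT hm v) := by
  obtain ⟨n, hn⟩ := exists_norm_volterra_pow_lt_one hκ hT hm v
  have h := isUnit_one_sub_of_norm_lt_one (R := Curve T m →L[ℝ] Curve T m) hn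
  rw [← mul_neg_geom_sum] at h
  refine ((Commute.isUnit_mul_iff ?_).1 h).1
  rw [Commute, SemiconjBy, mul_neg_geom_sum, geom_sum_mul_neg]

lemma norm_volterra_sub_le (v w : FlowH m) :
    ‖volterra (T := T) hκ hT hm v - volterra hκ hT hm w‖ ≤
      Real.sqrt (heatConst κ * T) * ‖adv hm‖ * ‖v - w‖ := by
  refine ContinuousLinearMap.opNorm_le_bound _ (by positivity) fun x => ?_
  have h1 : (volterra hκ hT hm v - volterra hκ hT hm w) x =
      duhamel hκ hT (advCurve hm w x - advCurve hm v x) := by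
    rw [map_sub, sub_apply]
    change -duhamel hκ hT (advCurve hm v x) - -duhamel hκ hT (advCurve hm w x) = _
    abel
  rw [h1, duhamel_apply]
  refine (norm_mild_zero_le hκ hT _).trans ?_
  rw [mul_assoc, mul_assoc]
  refine mul_le_mul_of_nonneg_left ?_ (Real.sqrt_nonneg _)
  refine (ContinuousMap.norm_le _ (by positivity)).2 fun t => ?_
  have h2 : (advCurve hm w x - advCurve hm v x) t = adv hm (w - v) (x t) := by
    rw [ContinuousMap.sub_apply, advCurve_apply, advCurve_apply, map_sub,
      sub_apply]
  rw [h2]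
  refine ((adv hm (w - v)).le_opNorm _).trans ?_
  rw [← mul_assoc, norm_sub_rev v w]
  exact mul_le_mul ((adv hm).le_opNorm _) (x.norm_coe_le_norm t) (norm_nonneg _) (by positivity)

lemma continuous_volterra : Continuous (volterra (T := T) hκ hT hm) := by
  refine continuous_iff_continuousAt.2 fun w => ?_
  refine (tendsto_iff_norm_sub_tendsto_zero (E := Curve T m →L[ℝ] Curve T m)).2 ?_
  refine squeeze_zero (fun _ => ContinuousLinearMap.opNorm_nonneg _) (fun v => norm_volterra_sub_le hκ hT hm v w) ?_
  have : Filter.Tendsto (fun v => ‖v - w‖) (nhds w) (nhds 0) :=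
    tendsto_iff_norm_sub_tendsto_zero.1 Filter.tendsto_id
  simpa using this.const_mul (Real.sqrt (heatConst κ * T) * ‖adv hm‖)

/-- The solution of the advection-diffusion equation, as a curve in `H^m`. -/
def solCurve (v : FlowH m) (a : ScalarH m) : Curve T m :=
  Ring.inverse (1 - volterra hκ hT hm v) (mild hκ hT a 0)

/-- By superposition the right-hand fixed point equation is `(1 - volterra) x = mild a 0`, and
`Ring.inverse` is a true inverse at a unit. -/
lemma eq_solCurve_iff (v : FlowH m) (a : ScalarH m) (x : Curve T m) :
    x = solCurve hκ hT hm v a ↔ x = mild hκ hT a (-advCurve hm v x) := by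
  have hu := isUnit_one_sub_volterra (T := T) hκ hT hm v
  have h1 : x = mild hκ hT a (-advCurve hm v x) ↔
      (1 - volterra hκ hT hm v) x = mild hκ hT a 0 := by
    have h2 : mild hκ hT a (-advCurve hm v x) = mild hκ hT a 0 + volterra hκ hT hm v x := by
      have h3 : volterra hκ hT hm v x = duhamel hκ hT (-advCurve hm v x) := by
        rw [map_neg]; rfl
      rw [h3, duhamel_apply, ← mild_add, add_zero, zero_add]
    rw [h2, sub_apply, one_apply_eq_self, sub_eq_iff_eq_add]
  rw [h1, solCurve]
  constructor
  · intro h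
    rw [h, ← mul_apply_eq_comp, Ring.mul_inverse_cancel _ hu,
      one_apply_eq_self]
  · intro h
    rw [← h, ← mul_apply_eq_comp, Ring.inverse_mul_cancel _ hu,
      one_apply_eq_self]

/-- Inversion is continuous at the units of the Banach algebra of bounded operators, and `volterra`
depends continuously on `v` in operator norm. -/
lemma continuous_solCurve (a : ScalarH m) :
    Continuous fun v : FlowH m => (solCurve hκ hT hm v a : Curve T m) := by
  refine continuous_iff_continuousAt.2 fun v => ?_
  obtain ⟨u, hu⟩ := isUnit_one_sub_volterra (T := T) hκ hT hm v
  have h1 : ContinuousAt Ring.inverse (1 - volterra (T := T) hκ hT hm v) := by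
    rw [← hu]
    exact NormedRing.inverse_continuousAt (R := Curve T m →L[ℝ] Curve T m) u
  have h2 : ContinuousAt (fun v => Ring.inverse (1 - volterra (T := T) hκ hT hm v)) v :=
    ContinuousAt.comp (f := fun v => 1 - volterra (T := T) hκ hT hm v) h1
      (continuous_const.sub (continuous_volterra hκ hT hm)).continuousAt
  exact h2.clm_apply continuousAt_const

end Volterra

end AdvectionDiffusion

/-! ### Weak solutions are the solutions of the Volterra equation -/

namespace AdvectionDiffusion

variable {κ T m : ℝ}

lemma heatOp_weight (κ : ℝ) (c : ScalarH (m + 1)) (k : Fin 2 → ℤ) :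
    freqNorm k ^ (2 * (m - 1)) * ‖(eigenval κ k : ℂ) * c.coeff k‖ ^ 2 =
      (4 * Real.pi ^ 2 * κ) ^ 2 * (freqNorm k ^ (2 * (m + 1)) * ‖c.coeff k‖ ^ 2) := by
  by_cases hk : k = 0
  · subst hk
    simp
  · have e : freqNorm k ^ (2 * (m + 1)) = freqNorm k ^ (2 * (m - 1)) * (freqNorm k ^ 2) ^ 2 := by
      rw [← pow_mul, ← Real.rpow_natCast, ← Real.rpow_add (freqNorm_pos hk)]
      congr 1
      push_cast
      ring
    rw [norm_mul, Complex.norm_real, mul_pow, Real.norm_eq_abs, sq_abs, e, eigenval]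
    ring

lemma sum_heatOp_le (κ : ℝ) (c : ScalarH (m + 1)) (F : Finset (Fin 2 → ℤ)) :
    ∑ k ∈ F, freqNorm k ^ (2 * (m - 1)) * ‖(eigenval κ k : ℂ) * c.coeff k‖ ^ 2 ≤
      (4 * Real.pi ^ 2 * κ) ^ 2 * ‖c‖ ^ 2 := by
  simp_rw [heatOp_weight]
  rw [← Finset.mul_sum]
  exact mul_le_mul_of_nonneg_left (c.sum_le_norm_sq F) (sq_nonneg _)

/-- The operator `-κΔ` on coefficients. -/
def heatFun (κ : ℝ) (c : ScalarH (m + 1)) : ScalarH (m - 1) :=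
  Sobolev.ofCoeff (fun k => (eigenval κ k : ℂ) * c.coeff k) (by simp)
    (fun k => by
      rw [map_mul, Complex.conj_ofReal, conj_scalar_coeff, Complex.ofReal_one, one_mul, eigenval,
        eigenval, freqNorm_neg])
    (summable_of_sum_le (fun k => Sobolev.weight_nonneg _ _ _) (sum_heatOp_le κ c))

lemma coeff_heatFun (κ : ℝ) (c : ScalarH (m + 1)) (k : Fin 2 → ℤ) :
    (heatFun κ c).coeff k = (eigenval κ k : ℂ) * c.coeff k := rfl

/-- The operator `-κΔ : H^{m+1} → H^{m-1}`. -/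
def heatOp (κ : ℝ) : ScalarH (m + 1) →L[ℝ] ScalarH (m - 1) :=
  LinearMap.mkContinuous
    { toFun := heatFun κ
      map_add' := fun a b => Sobolev.ext fun k => by
        rw [Sobolev.coeff_add, coeff_heatFun, coeff_heatFun, coeff_heatFun, Sobolev.coeff_add,
          mul_add]
      map_smul' := fun r a => Sobolev.ext fun k => by
        rw [RingHom.id_apply, Sobolev.coeff_smul, coeff_heatFun, coeff_heatFun,
          Sobolev.coeff_smul, mul_left_comm] }
    (|4 * Real.pi ^ 2 * κ|) fun c => by
      refine (sq_le_sq₀ (norm_nonneg _) (by positivity)).1 ?_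
      rw [mul_pow, sq_abs]
      exact Sobolev.norm_sq_le (sum_heatOp_le κ c)

lemma coeff_heatOp (κ : ℝ) (c : ScalarH (m + 1)) (k : Fin 2 → ℤ) :
    (heatOp κ c).coeff k = (eigenval κ k : ℂ) * c.coeff k := coeff_heatFun κ c k

/-- The mild solution is square integrable in time with values in `H^{m+1}`. -/
lemma exists_memLp_mild (hκ : 0 < κ) (hT : 0 ≤ T) (a : ScalarH m) (f : Curve T (m - 1)) :
    ∃ Θ : ℝ → ScalarH (m + 1), MemLp Θ 2 (volume.restrict (Icc 0 T)) ∧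
      ∀ᵐ t ∂(volume.restrict (Icc 0 T)), ∀ k, (Θ t).coeff k = mildCoeff κ hT a f t k := by
  have hc : ∀ k, Continuous fun s =>
      freqNorm k ^ (2 * (m + 1)) * ‖mildCoeff κ hT a f s k‖ ^ 2 := fun k =>
    continuous_const.mul ((continuous_mildCoeff hT a f k).norm.pow 2)
  refine Sobolev.exists_memLp_two (mildCoeff_zero_freq hT a f)
    (fun t k => by rw [conj_mildCoeff, Complex.ofReal_one, one_mul])
    (fun k => (continuous_mildCoeff hT a f k).aestronglyMeasurable) ?_
  have h1 : ∀ k, ∫⁻ s in Icc 0 T, ENNReal.ofReal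
      (freqNorm k ^ (2 * (m + 1)) * ‖mildCoeff κ hT a f s k‖ ^ 2) = ENNReal.ofReal
      (∫ s in (0 : ℝ)..T, freqNorm k ^ (2 * (m + 1)) * ‖mildCoeff κ hT a f s k‖ ^ 2) := by
    intro k
    rw [intervalIntegral.integral_of_le hT, ← integral_Icc_eq_integral_Ioc,
      ofReal_integral_eq_lintegral_ofReal ((hc k).integrableOn_Icc)
        (Filter.Eventually.of_forall fun s => Sobolev.weight_nonneg _ _ _)]
  simp_rw [h1]
  refine ne_top_of_le_ne_top ENNReal.ofReal_ne_top (b := ENNReal.ofReal (heatConst κ *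
    (‖a‖ ^ 2 + heatConst κ * ∫ s in (0 : ℝ)..T, ‖extend hT f s‖ ^ 2))) ?_
  rw [ENNReal.tsum_eq_iSup_sum]
  refine iSup_le fun F => ?_
  rw [← ENNReal.ofReal_sum_of_nonneg fun k _ => intervalIntegral.integral_nonneg hT
    fun s _ => Sobolev.weight_nonneg _ _ _]
  exact ENNReal.ofReal_le_ofReal (sum_integral_mildCoeff_le hκ hT a f F)

lemma coeff_extend_neg_advCurve (hm : 1 < m) (hT : 0 ≤ T) (v : FlowH m) (x : Curve T m) (t : ℝ)
    (k : Fin 2 → ℤ) :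
    (extend hT (-advCurve hm v x) t).coeff k = -advCoeff v (extend hT x t) k := by
  change -(extend hT (advCurve hm v x) t).coeff k = _
  rw [extend_advCurve, coeff_adv]

lemma mildCoeff_zero_time (hT : 0 ≤ T) (a : ScalarH m) (f : Curve T (m - 1)) (k : Fin 2 → ℤ) :
    mildCoeff κ hT a f 0 k = a.coeff k := relax_zero

lemma solCurve_eq (hκ : 0 < κ) (hT : 0 ≤ T) (hm : 1 < m) (v : FlowH m) (a : ScalarH m) :
    solCurve hκ hT hm v a = mild hκ hT a (-advCurve hm v (solCurve hκ hT hm v a)) :=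
  (eq_solCurve_iff hκ hT hm v a _).1 rfl

lemma coeff_extend_solCurve (hκ : 0 < κ) (hT : 0 ≤ T) (hm : 1 < m) (v : FlowH m)
    (a : ScalarH m) {t : ℝ} (ht : t ∈ Icc 0 T) (k : Fin 2 → ℤ) :
    (extend hT (solCurve hκ hT hm v a) t).coeff k =
      mildCoeff κ hT a (-advCurve hm v (solCurve hκ hT hm v a)) t k := by
  rw [extend_of_mem hT _ ht]
  conv_lhs => rw [solCurve_eq]
  rfl

lemma extend_solCurve_zero (hκ : 0 < κ) (hT : 0 ≤ T) (hm : 1 < m) (v : FlowH m)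
    (a : ScalarH m) : extend hT (solCurve hκ hT hm v a) 0 = a :=
  Sobolev.ext fun k => by
    rw [coeff_extend_solCurve hκ hT hm v a ⟨le_rfl, hT⟩, mildCoeff_zero_time]

/-- Existence of weak solutions. -/
theorem isWeakSolution_solCurve (hκ : 0 < κ) (hT : 0 ≤ T) (hm : 1 < m) (v : FlowH m)
    (a : ScalarH m) : IsWeakSolution κ T v a (extend hT (solCurve hκ hT hm v a)) := by
  set x := solCurve hκ hT hm v a with hx
  set f := -advCurve hm v x with hf
  have hco : ∀ t ∈ Icc 0 T, ∀ k, (extend hT x t).coeff k = mildCoeff κ hT a f t k :=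
    fun t ht k => coeff_extend_solCurve hκ hT hm v a ht k
  obtain ⟨Θ, hΘ, hΘc⟩ := exists_memLp_mild hκ hT a f
  have hmem : ∀ᵐ t ∂(volume.restrict (Icc 0 T)), t ∈ Icc 0 T := ae_restrict_mem measurableSet_Icc
  have hΘx : ∀ᵐ t ∂(volume.restrict (Icc 0 T)), ∀ k,
      (Θ t).coeff k = (extend hT x t).coeff k := by
    filter_upwards [hΘc, hmem] with t h1 h2 k
    rw [h1, hco t h2]
  -- The time derivative is read off from the equation: `∂ₜθ = -v · ∇θ + κΔθ`, where `heatOp κ` is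
  -- `-κΔ` and the Laplacian acts on the `H^{m+1}` version `Θ`.
  refine ⟨(continuous_extend hT x).continuousOn, extend_solCurve_zero hκ hT hm v a, Θ,
    fun t => -adv hm v (extend hT x t) - heatOp κ (Θ t), hΘ, ?_, hΘx, ?_, ?_⟩
  · have h1 : MemLp (fun t => -adv hm v (extend hT x t)) 2 (volume.restrict (Icc 0 T)) := by
      refine MemLp.of_bound (C := ‖adv hm v‖ * ‖x‖)
        ((adv hm v).continuous.comp (continuous_extend hT x)).neg.aestronglyMeasurable
        (Filter.Eventually.of_forall fun t => ?_)
      rw [norm_neg]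
      exact ((adv hm v).le_opNorm _).trans
        (mul_le_mul_of_nonneg_left (norm_extend_le hT x t) (norm_nonneg _))
    exact h1.sub ((heatOp κ).comp_memLp' hΘ)
  · intro t ht k
    rw [hco t ht, extend_solCurve_zero hκ hT hm v a, mildCoeff,
      relax_integral_eq (continuous_coeff_extend hT f k)]
    congr 1
    refine intervalIntegral.integral_congr_ae ?_
    have h := (ae_restrict_iff' measurableSet_Icc).1 hΘc
    filter_upwards [h] with s hs hs'
    rw [uIoc_of_le ht.1] at hs'
    have hsI : s ∈ Icc 0 T := ⟨hs'.1.le, hs'.2.trans ht.2⟩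
    rw [Sobolev.coeff_sub, Sobolev.coeff_neg, coeff_heatOp, coeff_adv, hs hsI,
      hf, coeff_extend_neg_advCurve]
    rfl
  · filter_upwards [hΘx] with t ht
    refine (weak_form_iff κ hm v (Θ t) (extend hT x t) ht _).2 fun k => ?_
    rw [Sobolev.coeff_sub, Sobolev.coeff_neg, coeff_heatOp, coeff_adv, ht]
    ring

/-- Uniqueness of weak solutions. -/
theorem IsWeakSolution.eq_solCurve (hκ : 0 < κ) (hT : 0 ≤ T) (hm : 1 < m) {v : FlowH m}
    {a : ScalarH m} {θ : ℝ → ScalarH m} (h : IsWeakSolution κ T v a θ) {t : ℝ}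
    (ht : t ∈ Icc 0 T) : θ t = extend hT (solCurve hκ hT hm v a) t := by
  obtain ⟨hcont, hinit, Θ, dθ, -, -, hΘ, hint, hweak⟩ := h
  set x : Curve T m := ⟨fun t => θ t, hcont.domRestrict⟩ with hx
  have hxt : ∀ t ∈ Icc 0 T, extend hT x t = θ t := fun t ht => by
    rw [extend_of_mem hT x ht]
    rfl
  have key : x = solCurve hκ hT hm v a := by
    rw [eq_solCurve_iff]
    refine ContinuousMap.ext fun t => Sobolev.ext fun k => ?_
    rw [coeff_mild, mildCoeff]
    have h1 : (x t).coeff k = (extend hT x t).coeff k := by rw [extend_of_mem hT x t.2]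
    rw [h1]
    -- For almost every time the weak form expresses the coefficient of `dθ` as source minus `λ_k`
    -- times that of `θ`, so each coefficient solves the integrated scalar equation, whose solution
    -- is unique.
    refine eq_relax (y := fun t => (extend hT x t).coeff k)
      (continuous_coeff_extend hT _ k) (continuous_coeff_extend hT x k) ?_ t.2
    intro t ht
    rw [hxt t ht, hint t ht k, hinit]
    congr 1
    refine intervalIntegral.integral_congr_ae ?_
    have h2 := (ae_restrict_iff' measurableSet_Icc).1 hΘ
    have h3 := (ae_restrict_iff' measurableSet_Icc).1 hweak
    filter_upwards [h2, h3] with s hs2 hs3 hs'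
    rw [uIoc_of_le ht.1] at hs'
    have hsI : s ∈ Icc 0 T := ⟨hs'.1.le, hs'.2.trans ht.2⟩
    have h4 := (weak_form_iff κ hm v (Θ s) (θ s) (hs2 hsI) _).1 (hs3 hsI) k
    rw [coeff_extend_neg_advCurve, hxt s hsI]
    linear_combination h4
  rw [← key, hxt t ht]

/-! ### From curves in `H^m` to fields in `L²([0, T] × 𝕋²)` -/

section Field

variable (hT : 0 ≤ T) (hm : 1 < m)

/-- The scalar field `(t, x) ↦ θ(t, x)` of a curve, as a continuous function. -/
def fieldFun (x : Curve T m) (p : ℝ × T2) : ℝ := contFun hm (extend hT x p.1) p.2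

lemma continuous_fieldFun (x : Curve T m) : Continuous (fieldFun hT hm x) := by
  have h : Continuous fun p : ℝ × T2 => contFun hm (extend hT x p.1) :=
    (contFun hm).continuous.comp ((continuous_extend hT x).comp continuous_fst)
  exact h.eval continuous_snd

lemma norm_fieldFun_le (x : Curve T m) (p : ℝ × T2) :
    ‖fieldFun hT hm x p‖ ≤ ‖contFun hm‖ * ‖x‖ :=
  ((contFun hm (extend hT x p.1)).norm_coe_le_norm p.2).trans
    (((contFun hm).le_opNorm _).trans
      (mul_le_mul_of_nonneg_left (norm_extend_le hT x _) (norm_nonneg _)))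

lemma memLp_fieldFun (x : Curve T m) : MemLp (fieldFun hT hm x) 2 (spaceTime T) :=
  MemLp.of_bound (continuous_fieldFun hT hm x).aestronglyMeasurable (‖contFun hm‖ * ‖x‖)
    (Filter.Eventually.of_forall (norm_fieldFun_le hT hm x))

lemma fieldFun_sub (x y : Curve T m) (p : ℝ × T2) :
    fieldFun hT hm (x - y) p = fieldFun hT hm x p - fieldFun hT hm y p := by
  have h : extend hT (x - y) p.1 = extend hT x p.1 - extend hT y p.1 := rfl
  rw [fieldFun, h, map_sub]
  rfl

/-- The scalar field of a curve, as an element of `L²([0, T] × 𝕋²)`. -/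
def field (x : Curve T m) : SpaceTimeL2 T := (memLp_fieldFun hT hm x).toLp (fieldFun hT hm x)

lemma coeFn_field (x : Curve T m) : field hT hm x =ᵐ[spaceTime T] fieldFun hT hm x :=
  (memLp_fieldFun hT hm x).coeFn_toLp

lemma norm_field_sub_le (x y : Curve T m) : ‖field hT hm x - field hT hm y‖ ≤
    (measureUnivNNReal (spaceTime T) : ℝ) ^ (2 : ℝ≥0∞).toReal⁻¹ * (‖contFun hm‖ * ‖x - y‖) := by
  refine Lp.norm_le_of_ae_bound (by positivity) ?_
  filter_upwards [coeFn_field hT hm x, coeFn_field hT hm y,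
    Lp.coeFn_sub (field hT hm x) (field hT hm y)] with p h1 h2 h3
  rw [h3, Pi.sub_apply, h1, h2, ← fieldFun_sub]
  exact norm_fieldFun_le hT hm _ p

lemma continuous_field : Continuous (field (T := T) hT hm) := by
  refine continuous_iff_continuousAt.2 fun y => ?_
  refine tendsto_iff_norm_sub_tendsto_zero.2 ?_
  refine squeeze_zero (fun _ => norm_nonneg _) (fun x => norm_field_sub_le hT hm x y) ?_
  have : Filter.Tendsto (fun x => ‖x - y‖) (nhds y) (nhds 0) :=
    tendsto_iff_norm_sub_tendsto_zero.1 Filter.tendsto_id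
  simpa using (this.const_mul ‖contFun hm‖).const_mul _

lemma ae_field_eq (x : Curve T m) :
    ∀ᵐ t ∂(volume.restrict (Icc 0 T)), ∀ᵐ y ∂area,
      field hT hm x (t, y) = scalarFun (extend hT x t) y := by
  filter_upwards [Measure.ae_ae_of_ae_prod (coeFn_field hT hm x)] with t ht
  filter_upwards [ht, contFun_ae_eq hm (extend hT x t)] with y h1 h2
  rw [h1, ← h2]
  rfl

/-- Agreement at almost every `y` for almost every `t` passes to the product measure by Fubini,
because the set where `u` and the field coincide is measurable. -/
lemma eq_field_of_ae {u : SpaceTimeL2 T} {x : Curve T m}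
    (h : ∀ᵐ t ∂(volume.restrict (Icc 0 T)), ∀ᵐ y ∂area,
      u (t, y) = scalarFun (extend hT x t) y) : u = field hT hm x := by
  apply Lp.ext
  have hmeas : MeasurableSet {p : ℝ × T2 | u p = field hT hm x p} :=
    measurableSet_eq_fun (Lp.stronglyMeasurable u).measurable
      (Lp.stronglyMeasurable (field hT hm x)).measurable
  refine (Measure.ae_prod_iff_ae_ae hmeas).2 ?_
  filter_upwards [h, ae_field_eq hT hm x] with t h1 h2
  filter_upwards [h1, h2] with y h3 h4
  rw [h3, h4]

/-- Equal fields give equal curves at almost every time, and continuity extends this to all of `[0,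
T]`, an interval of positive length. -/
lemma field_injective (hT' : 0 < T) {x y : Curve T m}
    (h : field hT'.le hm x = field hT'.le hm y) : x = y := by
  have h1 : extend hT'.le x =ᵐ[volume.restrict (Icc 0 T)] extend hT'.le y := by
    filter_upwards [ae_field_eq hT'.le hm x, ae_field_eq hT'.le hm y] with t hx hy
    refine scalarFun_injective (by linarith) ?_
    filter_upwards [hx, hy] with z h3 h4
    rw [← h3, ← h4, h]
  have h2 := Measure.eqOn_Icc_of_ae_eq volume hT'.ne h1
    (continuous_extend hT'.le x).continuousOn (continuous_extend hT'.le y).continuousOn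
  refine ContinuousMap.ext fun t => ?_
  have := h2 t.2
  rwa [extend_of_mem _ _ t.2, extend_of_mem _ _ t.2] at this

end Field

/-- The scalar field of the weak solution. -/
theorem isSolutionField_iff (hκ : 0 < κ) (hT : 0 ≤ T) (hm : 1 < m) (v : FlowH m) (a : ScalarH m)
    (u : SpaceTimeL2 T) :
    IsSolutionField κ T v a u ↔ u = field hT hm (solCurve hκ hT hm v a) := by
  constructor
  · rintro ⟨θ, hθ, hu⟩
    refine eq_field_of_ae hT hm ?_
    filter_upwards [hu, ae_restrict_mem measurableSet_Icc] with t h1 h2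
    rwa [hθ.eq_solCurve hκ hT hm h2] at h1
  · rintro rfl
    exact ⟨_, isWeakSolution_solCurve hκ hT hm v a, ae_field_eq hT hm _⟩

/-- Existence makes the choice in `solution` satisfy its predicate, and uniqueness identifies the
chosen field. -/
lemma solution_eq (hκ : 0 < κ) (hT : 0 ≤ T) (hm : 1 < m) (v : FlowH m) (a : ScalarH m) :
    solution κ T a v = field hT hm (solCurve hκ hT hm v a) :=
  (isSolutionField_iff hκ hT hm v a _).1 (Classical.epsilon_spec
    (p := IsSolutionField κ T v a) ⟨_, (isSolutionField_iff hκ hT hm v a _).2 rfl⟩)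

end AdvectionDiffusion

/-! ### Rellich's theorem -/

namespace AdvectionDiffusion

namespace Sobolev

variable {σ s t : ℝ}

/-- The frequencies in a square box. -/
def box (n : ℕ) : Finset (Fin 2 → ℤ) := Finset.Icc (fun _ => -(n : ℤ)) (fun _ => (n : ℤ))

lemma mem_box {n : ℕ} {k : Fin 2 → ℤ} : k ∈ box n ↔ ∀ i, |k i| ≤ n := by
  simp only [box, Finset.mem_Icc, Pi.le_def, abs_le, forall_and]

lemma neg_mem_box {n : ℕ} {k : Fin 2 → ℤ} : -k ∈ box n ↔ k ∈ box n := by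
  simp only [mem_box, Pi.neg_apply, abs_neg]

lemma le_freqNorm_of_notMem_box {n : ℕ} {k : Fin 2 → ℤ} (hk : k ∉ box n) :
    (n : ℝ) ≤ freqNorm k := by
  rw [mem_box] at hk
  push Not at hk
  obtain ⟨i, hi⟩ := hk
  refine le_trans ?_ (abs_le_freqNorm k i)
  exact_mod_cast hi.le

lemma weight_mono (h : s ≤ t) (c : Sobolev σ t) (k : Fin 2 → ℤ) :
    freqNorm k ^ (2 * s) * ‖c.coeff k‖ ^ 2 ≤ freqNorm k ^ (2 * t) * ‖c.coeff k‖ ^ 2 := by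
  by_cases hk : k = 0
  · simp [hk]
  · exact mul_le_mul_of_nonneg_right
      (Real.rpow_le_rpow_of_exponent_le (one_le_freqNorm hk) (by linarith)) (sq_nonneg _)

lemma norm_incl_le (h : s ≤ t) (c : Sobolev σ t) : ‖incl h c‖ ≤ ‖c‖ := by
  refine (sq_le_sq₀ (norm_nonneg _) (norm_nonneg _)).1 (norm_sq_le fun F => ?_)
  refine le_trans (Finset.sum_le_sum fun k _ => ?_) (c.sum_le_norm_sq F)
  rw [coeff_incl]
  exact weight_mono h c k

/-- The inclusion of Sobolev spaces, as a continuous linear map. -/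
def inclL (h : s ≤ t) : Sobolev σ t →L[ℝ] Sobolev σ s :=
  LinearMap.mkContinuous
    { toFun := incl h
      map_add' := fun a b => ext fun k => by simp only [coeff_incl, coeff_add]
      map_smul' := fun r a => ext fun k => by
        simp only [coeff_incl, coeff_smul, RingHom.id_apply] } 1 fun c => by
      rw [one_mul]
      exact norm_incl_le h c

lemma inclL_apply (h : s ≤ t) (c : Sobolev σ t) : inclL h c = incl h c := rfl

/-- The truncation of the Fourier series to a box of frequencies. -/
def truncFun (n : ℕ) (c : Sobolev σ t) : Sobolev σ s :=
  ofCoeff (fun k => if k ∈ box n then c.coeff k else 0) (by simp)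
    (fun k => by
      simp only [neg_mem_box]
      split_ifs
      · exact c.conj_coeff k
      · simp)
    (summable_of_ne_finset_zero (s := box n) fun k hk => by simp [hk])

lemma coeff_truncFun (n : ℕ) (c : Sobolev σ t) (k : Fin 2 → ℤ) :
    (truncFun n c : Sobolev σ s).coeff k = if k ∈ box n then c.coeff k else 0 := rfl

/-- The truncation of the Fourier series, as a continuous linear map. -/
def trunc (h : s ≤ t) (n : ℕ) : Sobolev σ t →L[ℝ] Sobolev σ s :=
  LinearMap.mkContinuous
    { toFun := truncFun n
      map_add' := fun a b => ext fun k => by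
        simp only [coeff_truncFun, coeff_add]
        split_ifs <;> simp
      map_smul' := fun r a => ext fun k => by
        simp only [coeff_truncFun, coeff_smul, RingHom.id_apply]
        split_ifs <;> simp } 1 fun c => by
      rw [one_mul]
      refine (sq_le_sq₀ (norm_nonneg _) (norm_nonneg _)).1 (norm_sq_le fun F => ?_)
      refine le_trans (Finset.sum_le_sum fun k _ => ?_) (c.sum_le_norm_sq F)
      change freqNorm k ^ (2 * s) * ‖if k ∈ box n then c.coeff k else 0‖ ^ 2 ≤ _
      split_ifs
      · exact weight_mono h c k
      · rw [norm_zero, zero_pow two_ne_zero, mul_zero]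
        exact weight_nonneg _ _ _

lemma trunc_apply (h : s ≤ t) (n : ℕ) (c : Sobolev σ t) : trunc h n c = truncFun n c := rfl

/-- Only frequencies with `‖k‖ ≥ n` survive in the difference, and there `‖k‖^s ≤ n^{-(t-s)} ‖k‖^t`.
-/
lemma norm_inclL_sub_trunc_le (h : s ≤ t) {n : ℕ} (hn : 0 < n) :
    ‖(inclL h : Sobolev σ t →L[ℝ] Sobolev σ s) - trunc h n‖ ≤ (n : ℝ) ^ (-(t - s)) := by
  have hn' : (0 : ℝ) < n := by exact_mod_cast hn
  refine ContinuousLinearMap.opNorm_le_bound _ (Real.rpow_nonneg hn'.le _) fun c => ?_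
  refine (sq_le_sq₀ (norm_nonneg _)
    (mul_nonneg (Real.rpow_nonneg hn'.le _) (norm_nonneg _))).1 (norm_sq_le fun F => ?_)
  rw [mul_pow]
  refine le_trans ?_ (mul_le_mul_of_nonneg_left (c.sum_le_norm_sq F) (sq_nonneg _))
  rw [Finset.mul_sum]
  refine Finset.sum_le_sum fun k _ => ?_
  rw [sub_apply, coeff_sub, inclL_apply, trunc_apply, coeff_incl, coeff_truncFun]
  split_ifs with hk
  · rw [sub_self, norm_zero, zero_pow two_ne_zero, mul_zero]
    exact mul_nonneg (sq_nonneg _) (weight_nonneg _ _ _)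
  · rw [sub_zero, ← mul_assoc]
    refine mul_le_mul_of_nonneg_right ?_ (sq_nonneg _)
    have h1 := le_freqNorm_of_notMem_box hk
    have h2 : freqNorm k ^ (-(t - s)) ≤ (n : ℝ) ^ (-(t - s)) :=
      Real.rpow_le_rpow_of_nonpos hn' h1 (by linarith)
    have h3 : freqNorm k ^ (2 * s) = (freqNorm k ^ (-(t - s))) ^ 2 * freqNorm k ^ (2 * t) := by
      rw [freqNorm_rpow_sq, freqNorm_rpow_sq, ← mul_pow, ← Real.rpow_add (hn'.trans_le h1)]
      ring_nf
    rw [h3]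
    exact mul_le_mul_of_nonneg_right
      (pow_le_pow_left₀ (Real.rpow_nonneg (freqNorm_nonneg k) _) h2 2)
      (freqNorm_rpow_nonneg _ _)

/-- The truncation has finite rank: an element of its range is determined by its coefficients in the
box. -/
lemma isCompactOperator_trunc (h : s ≤ t) (n : ℕ) :
    IsCompactOperator (trunc h n : Sobolev σ t →L[ℝ] Sobolev σ s) := by
  set P : Sobolev σ t →L[ℝ] Sobolev σ s := trunc h n with hP
  set R := LinearMap.range P.toLinearMap with hR
  let ev : R →ₗ[ℝ] (box n → ℂ) :=
    { toFun := fun c k => (c : Sobolev σ s).coeff k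
      map_add' := fun _ _ => rfl
      map_smul' := fun r c => funext fun k => by
        change ((r • (c : Sobolev σ s)).coeff k) = _
        simp }
  have hev : Function.Injective ev := by
    rintro ⟨_, a, rfl⟩ ⟨_, b, rfl⟩ hab
    refine Subtype.ext (ext fun k => ?_)
    by_cases hk : k ∈ box n
    · exact congrFun hab ⟨k, hk⟩
    · change (truncFun n a : Sobolev σ s).coeff k = (truncFun n b : Sobolev σ s).coeff k
      rw [coeff_truncFun, coeff_truncFun, if_neg hk, if_neg hk]
  have : FiniteDimensional ℝ R := FiniteDimensional.of_injective ev hev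
  have : ProperSpace R := FiniteDimensional.proper_real R
  let Q : Sobolev σ t →L[ℝ] R := P.codRestrict R fun c => ⟨c, rfl⟩
  have hQ : IsCompactOperator Q := isCompactOperator_of_locallyCompactSpace_dom Q
  exact hQ.clm_comp R.subtypeL

/-- **Rellich's theorem**. -/
theorem isCompactOperator_inclL (h : s < t) :
    IsCompactOperator (inclL h.le : Sobolev σ t →L[ℝ] Sobolev σ s) := by
  refine isCompactOperator_of_tendsto (l := Filter.atTop) (F := fun n : ℕ => trunc h.le n) ?_
    (Filter.Eventually.of_forall fun n => isCompactOperator_trunc h.le n)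
  rw [tendsto_iff_norm_sub_tendsto_zero]
  have h1 : Filter.Tendsto (fun n : ℕ => (n : ℝ) ^ (-(t - s))) Filter.atTop (nhds 0) :=
    (tendsto_rpow_neg_atTop (sub_pos.2 h)).comp tendsto_natCast_atTop_atTop
  refine squeeze_zero' (Filter.Eventually.of_forall fun _ => norm_nonneg _) ?_ h1
  filter_upwards [Filter.eventually_gt_atTop 0] with n hn
  rw [norm_sub_rev]
  exact norm_inclL_sub_trunc_le h.le hn

end Sobolev

lemma isCompact_closure_ballV {m m' : ℝ} (h : m < m') (v₀ : FlowH m') (r : ℝ) :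
    IsCompact (closure (ballV h.le v₀ r)) :=
  (Sobolev.isCompactOperator_inclL (σ := -1) h).isCompact_closure_image_of_bounded
    (f := (Sobolev.inclL h.le).toLinearMap) Metric.isBounded_closedBall

/-! ### Continuity and injectivity of the solution map, and continuity of its inverse -/

variable {κ T m : ℝ}

lemma pairedSolutionMap_apply (hκ : 0 < κ) (hT : 0 ≤ T) (hm : 1 < m) (θ₀ : Fin 2 → ScalarH m)
    (v : FlowH m) (i : Fin 2) :
    pairedSolutionMap κ T θ₀ v i = field hT hm (solCurve hκ hT hm v (θ₀ i)) :=
  solution_eq hκ hT hm v (θ₀ i)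

lemma continuous_pairedSolutionMap (hκ : 0 < κ) (hT : 0 ≤ T) (hm : 1 < m)
    (θ₀ : Fin 2 → ScalarH m) : Continuous (pairedSolutionMap κ T θ₀) := by
  refine (PiLp.continuous_toLp 2 _).comp (continuous_pi fun i => ?_)
  simp_rw [solution_eq hκ hT hm]
  exact (continuous_field hT hm).comp (continuous_solCurve hκ hT hm (θ₀ i))

/-- A source is determined at the initial time by the mild solution. -/
lemma source_zero_eq (hκ : 0 < κ) (hT : 0 < T) {a : ScalarH m} {f g : Curve T (m - 1)}
    (h : mild hκ hT.le a f = mild hκ hT.le a g) : extend hT.le f 0 = extend hT.le g 0 := by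
  refine Sobolev.ext fun k => ?_
  have h0 : (0 : ℝ) ∈ Icc 0 T := ⟨le_rfl, hT.le⟩
  have heq : ∀ t ∈ Icc 0 T, mildCoeff κ hT.le a f t k = mildCoeff κ hT.le a g t k := by
    intro t ht
    rw [← coeff_mild hκ hT.le a f ⟨t, ht⟩, ← coeff_mild hκ hT.le a g ⟨t, ht⟩, h]
  -- At time 0 the coefficient has derivative `f_k(0) - λ_k a_k`. The two mild solutions agree only
  -- on `[0, T]`, so derivatives within this interval are compared.
  have hf := (hasDerivAt_relax (l := eigenval κ k) (a := a.coeff k)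
    (continuous_coeff_extend hT.le f k) 0).hasDerivWithinAt (s := Icc 0 T)
  have hg := (hasDerivAt_relax (l := eigenval κ k) (a := a.coeff k)
    (continuous_coeff_extend hT.le g k) 0).hasDerivWithinAt (s := Icc 0 T)
  have h1 := (uniqueDiffOn_Icc hT 0 h0).eq_deriv _ (hf.congr (fun t ht => (heq t ht).symm)
    (heq 0 h0).symm) hg
  rw [relax_zero, relax_zero] at h1
  linear_combination h1

/-- Both curves start at `a`, so at time 0 their sources are `-v · ∇a` and `-w · ∇a`;
`source_zero_eq` equates them. -/
lemma adv_eq_of_solCurve_eq (hκ : 0 < κ) (hT : 0 < T) (hm : 1 < m) {v w : FlowH m}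
    {a : ScalarH m} (h : solCurve hκ hT.le hm v a = solCurve hκ hT.le hm w a) :
    adv hm v a = adv hm w a := by
  have h1 : mild hκ hT.le a (-advCurve hm v (solCurve hκ hT.le hm v a)) =
      mild hκ hT.le a (-advCurve hm w (solCurve hκ hT.le hm w a)) := by
    rw [← solCurve_eq, ← solCurve_eq, h]
  have h2 := source_zero_eq hκ hT h1
  refine Sobolev.ext fun k => ?_
  have h3 := congrArg (fun c => Sobolev.coeff c k) h2
  rw [coeff_extend_neg_advCurve, coeff_extend_neg_advCurve, extend_solCurve_zero,
    extend_solCurve_zero] at h3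
  rw [coeff_adv, coeff_adv]
  linear_combination -h3

lemma advection_ae_eq_zero (hm : 1 < m) {v : FlowH m} {a : ScalarH m} (h : adv hm v a = 0) :
    advection v a =ᵐ[area] 0 := by
  have h1 : (fun x => (advection v a x : ℂ)) =ᵐ[area] fun _ => 0 := by
    refine ae_eq_of_fcoeff_eq (MemLp.ofReal (K := ℂ) (memLp_advection hm v a)) MemLp.zero
      fun k => ?_
    have h2 := congrArg (fun c => Sobolev.coeff c k) h
    rw [coeff_adv, advCoeff_eq_fcoeff hm] at h2
    refine h2.trans ?_
    simp [fcoeff]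
  filter_upwards [h1] with x hx
  exact_mod_cast hx

lemma eq_zero_of_velocity_ae_eq_zero (hm : 0 ≤ m) {v : FlowH m}
    (h : ∀ j, velocity v j =ᵐ[area] 0) : v = 0 := by
  have h1 : ∀ j k, velCoeff v j k = 0 := fun j k => by
    rw [← fcoeff_fourierSeries (memlp_velCoeff hm v j) (conj_velCoeff v j) k,
      fcoeff_congr_ae (g := fun _ => 0)]
    · simp [fcoeff]
    · filter_upwards [h j] with x hx
      rw [← velocity_eq, hx]
      simp
  refine Sobolev.ext fun k => ?_
  by_cases hk : k = 0
  · rw [hk, Sobolev.coeff_zero_freq, Sobolev.coeff_zero]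
  · rw [Sobolev.coeff_zero]
    by_contra hv
    have hn : (freqNorm k : ℂ) ≠ 0 := by exact_mod_cast (freqNorm_pos hk).ne'
    have h2 : ∀ j, freqPerp k j = 0 := fun j => by
      have := h1 j k
      simpa [velCoeff, hv, hn] using this
    apply hk
    have e0 := h2 0
    have e1 := h2 1
    simp only [freqPerp, Matrix.cons_val_zero, Matrix.cons_val_one, neg_eq_zero] at e0 e1
    ext i
    fin_cases i
    · exact e1
    · exact e0

theorem injective_pairedSolutionMap (hκ : 0 < κ) (hT : 0 < T) (hm : 1 < m)
    {θ₀ : Fin 2 → ScalarH m} (hθ₀ : TransverseGradients θ₀) :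
    Function.Injective (pairedSolutionMap κ T θ₀) := by
  intro v w hvw
  have h1 : ∀ i, advection (v - w) (θ₀ i) =ᵐ[area] 0 := fun i => by
    refine advection_ae_eq_zero hm ?_
    have h2 : field hT.le hm (solCurve hκ hT.le hm v (θ₀ i)) =
        field hT.le hm (solCurve hκ hT.le hm w (θ₀ i)) := by
      rw [← pairedSolutionMap_apply, ← pairedSolutionMap_apply, hvw]
    rw [map_sub, sub_apply, adv_eq_of_solCurve_eq hκ hT hm (field_injective hm hT h2), sub_self]
  -- Cramer's rule: the determinant of the system with rows `∇θ₀⁽¹⁾` and `∇θ₀⁽²⁾` is the expression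
  -- that transversality makes nonzero almost everywhere.
  have h3 : ∀ᵐ x ∂area, velocity (v - w) 0 x = 0 ∧ velocity (v - w) 1 x = 0 := by
    filter_upwards [h1 0, h1 1, hθ₀] with x ha hb hd
    simp only [advection, Fin.sum_univ_two, Pi.zero_apply] at ha hb
    constructor
    · refine (mul_eq_zero.1 ?_).resolve_right hd
      linear_combination gradFun (θ₀ 1) 1 x * ha - gradFun (θ₀ 0) 1 x * hb
    · refine (mul_eq_zero.1 ?_).resolve_right hd
      linear_combination gradFun (θ₀ 0) 0 x * hb - gradFun (θ₀ 1) 0 x * ha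
  refine sub_eq_zero.1 (eq_zero_of_velocity_ae_eq_zero (by linarith) fun j => ?_)
  fin_cases j
  · filter_upwards [h3] with x hx using hx.1
  · filter_upwards [h3] with x hx using hx.2

/-- A continuous injective map has a continuous inverse on the image of a relatively compact
set. -/
lemma continuousOn_invFun_image {X Y : Type*} [TopologicalSpace X] [TopologicalSpace Y]
    [T2Space Y] [Nonempty X] {f : X → Y} (hf : Continuous f) (hinj : Function.Injective f)
    {B : Set X} (hB : IsCompact (closure B)) : ContinuousOn (Function.invFun f) (f '' B) := by
  refine ContinuousOn.mono ?_ (image_mono subset_closure)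
  rw [continuousOn_iff_isClosed]
  intro C hC
  -- By injectivity the preimage of `C` under the inverse, within `f '' closure B`, is the image of
  -- the compact set `C ∩ closure B`, hence closed in the Hausdorff space `Y`.
  refine ⟨f '' (C ∩ closure B), ((hB.inter_left hC).image hf).isClosed, ?_⟩
  ext y
  constructor
  · rintro ⟨hy, x, hx, rfl⟩
    rw [mem_preimage, Function.leftInverse_invFun hinj x] at hy
    exact ⟨⟨x, ⟨hy, hx⟩, rfl⟩, ⟨x, hx, rfl⟩⟩
  · rintro ⟨⟨x, ⟨hxC, hxB⟩, rfl⟩, -⟩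
    refine ⟨?_, ⟨x, hxB, rfl⟩⟩
    rw [mem_preimage, Function.leftInverse_invFun hinj x]
    exact hxC

end AdvectionDiffusion

end

open AdvectionDiffusion
theorem corollary4p4 (κ T m m' : ℝ) (hκ : 0 < κ) (hT : 0 < T) (hm : 1 < m) (hm' : m < m')
    (θ₀ : Fin 2 → ScalarH m) (hθ₀ : TransverseGradients θ₀) :
    -- the paired solution map is well defined: the scalar fields exist and are unique
    (∀ (i : Fin 2) (v : FlowH m), ∃! u : SpaceTimeL2 T, IsSolutionField κ T v (θ₀ i) u) ∧
    -- it has an inverse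
    Function.Injective (pairedSolutionMap κ T θ₀) ∧
    -- which is continuous into `H` on the image of every ball of `V`
    (∀ (v₀ : FlowH m') (r : ℝ), 0 < r →
      ContinuousOn (Function.invFun (pairedSolutionMap κ T θ₀))
        (pairedSolutionMap κ T θ₀ '' ballV hm'.le v₀ r)) ∧
    ∀ (v₀ : FlowH m') (r : ℝ), 0 < r → ∀ ε : ℝ, 0 < ε → ∃ δ : ℝ, 0 < δ ∧
      {v : FlowH m | ‖pairedSolutionMap κ T θ₀ v -
          pairedSolutionMap κ T θ₀ (Sobolev.incl hm'.le v₀)‖ < δ} ∩ ballV hm'.le v₀ r ⊆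
        Metric.closedBall (Sobolev.incl hm'.le v₀) ε := by
  have hinj := injective_pairedSolutionMap hκ hT hm hθ₀
  have hcont : ∀ (v₀ : FlowH m') (r : ℝ),
      ContinuousOn (Function.invFun (pairedSolutionMap κ T θ₀))
        (pairedSolutionMap κ T θ₀ '' ballV hm'.le v₀ r) := fun v₀ r =>
    continuousOn_invFun_image (continuous_pairedSolutionMap hκ hT.le hm θ₀) hinj
      (isCompact_closure_ballV hm' v₀ r)
  refine ⟨fun i v => ⟨_, (isSolutionField_iff hκ hT.le hm v (θ₀ i) _).2 rfl, fun u hu =>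
    (isSolutionField_iff hκ hT.le hm v (θ₀ i) u).1 hu⟩, hinj, fun v₀ r _ => hcont v₀ r, ?_⟩
  intro v₀ r hr ε hε
  have hmem : Sobolev.incl hm'.le v₀ ∈ ballV hm'.le v₀ r :=
    ⟨v₀, Metric.mem_closedBall_self hr.le, rfl⟩
  -- The required `δ` is the one from continuity of the inverse at the image of `v₀`, the centre of
  -- the ball.
  obtain ⟨δ, hδ, h⟩ := Metric.continuousOn_iff.1 (hcont v₀ r) _ (Set.mem_image_of_mem _ hmem) ε hε
  refine ⟨δ, hδ, ?_⟩
  rintro v ⟨hv, hvB⟩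
  have h1 := h _ (Set.mem_image_of_mem _ hvB) (by rw [dist_eq_norm]; exact hv)
  rw [Function.leftInverse_invFun hinj, Function.leftInverse_invFun hinj] at h1
  exact Metric.mem_closedBall.2 h1.le
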